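/- **Theorem 1.1.** Let $B_n$ be the Artin braid group on $n$ strings, $\sigma\colon B_n\to S_n$ the projection sending the generator $\sigma_i$ to the transposition $(i,i+1)$, and $P_n=\ker\sigma$ the pure braid group. A *Bieberbach group of dimension $d$* is a torsion-free group isomorphic to a discrete and uniform (closed, with compact coset space) subgroup of $\mathbb{R}^d\rtimes \mathrm{O}(d)$. Its *holonomy group* is the finite group $\Phi$ in a short exact sequence $0\to\mathbb{Z}^d\to\Gamma\to\Phi\to 1$ for which the action of $\Phi$ on $\mathbb{Z}^d$ induced by conjugation in $\Gamma$ is faithful. Let $G$ be a finite abelian group. Then there exist an integer $n\ge 3$ such that $G$ embeds in the symmetric group $S_n$, and a subgroup $\Gamma_G$ of $B_n/[P_n,P_n]$, such that 1. $\Gamma_G$ is a Bieberbach group of dimension $n(n-1)/2$ with holonomy group $G$; 2. there is a closed (compact, connected, without boundary) flat Riemannian manifold $\mathcal{X}_{\Gamma_G}$ of dimension $n(n-1)/2$ whose holonomy group (the group of parallel transports around piecewise $C^1$ loops at a point) is isomorphic to $G$ and whose fundamental group is isomorphic to $\Gamma_G$. -/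

import Mathlib

open scoped Manifold ContDiff

noncomputable section

/-! ### Artin braid groups -/

/-- Artin's relators on the generators `σ_0, …, σ_{n-2}`: far commutation
`σ_i σ_j = σ_j σ_i` for `|i - j| ≥ 2`, and the braid relation
`σ_{i+1} σ_i σ_{i+1} = σ_i σ_{i+1} σ_i`. -/
def braidRelators (n : ℕ) : Set (FreeGroup (Fin (n - 1))) :=
  {r | ∃ i j : Fin (n - 1), (i : ℕ) + 2 ≤ (j : ℕ) ∧
      r = FreeGroup.of i * FreeGroup.of j * (FreeGroup.of j * FreeGroup.of i)⁻¹} ∪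
  {r | ∃ i j : Fin (n - 1), (j : ℕ) = (i : ℕ) + 1 ∧
      r = FreeGroup.of j * FreeGroup.of i * FreeGroup.of j *
        (FreeGroup.of i * FreeGroup.of j * FreeGroup.of i)⁻¹}

/-- The Artin braid group `B_n` on `n` strings. -/
abbrev BraidGroup (n : ℕ) : Type := PresentedGroup (braidRelators n)

/-- The transposition `(i, i+1)` in `S_n`. -/
def adjacentSwap (n : ℕ) (i : Fin (n - 1)) : Equiv.Perm (Fin n) :=
  Equiv.swap ⟨i, by have := i.isLt; omega⟩ ⟨i + 1, by have := i.isLt; omega⟩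

theorem adjacentSwap_relators (n : ℕ) :
    ∀ r ∈ braidRelators n, FreeGroup.lift (adjacentSwap n) r = 1 := by
  rintro r (⟨i, j, hij, rfl⟩ | ⟨i, j, hij, rfl⟩)
  · simp only [map_mul, map_inv, FreeGroup.lift_apply_of]
    rw [mul_inv_eq_one]
    refine Equiv.Perm.Disjoint.commute (Equiv.Perm.disjoint_swap_swap ?_)
    simp only [List.nodup_cons, List.mem_cons, List.not_mem_nil, or_false, Fin.mk.injEq,
      List.nodup_nil, not_false_eq_true, and_true]
    omega
  · simp only [map_mul, map_inv, FreeGroup.lift_apply_of]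
    rw [mul_inv_eq_one]
    have hj : adjacentSwap n j = Equiv.swap ⟨i + 1, by omega⟩ ⟨i + 2, by omega⟩ := by
      simp only [adjacentSwap, hij]
    rw [hj, adjacentSwap]
    rw [Equiv.swap_mul_swap_mul_swap (by simp [Fin.ext_iff]) (by simp [Fin.ext_iff])]
    rw [Equiv.swap_comm (⟨i, _⟩ : Fin n) ⟨i + 1, _⟩, Equiv.swap_comm (⟨i + 1, _⟩ : Fin n) ⟨i + 2, _⟩]
    rw [Equiv.swap_mul_swap_mul_swap (by simp [Fin.ext_iff]) (by simp [Fin.ext_iff])]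
    rw [Equiv.swap_comm]

/-- The projection `σ : B_n → S_n` sending the generator `σ_i` to `(i, i+1)`. -/
def braidPerm (n : ℕ) : BraidGroup n →* Equiv.Perm (Fin n) :=
  PresentedGroup.toGroup (adjacentSwap_relators n)

/-- The pure braid group `P_n`. -/
def pureBraidGroup (n : ℕ) : Subgroup (BraidGroup n) := (braidPerm n).ker

instance pureBraidGroup_normal (n : ℕ) : (pureBraidGroup n).Normal :=
  inferInstanceAs (braidPerm n).ker.Normal

/-- The quotient group `B_n / [P_n, P_n]`. -/
abbrev BraidQuotient (n : ℕ) : Type :=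
  BraidGroup n ⧸ ⁅pureBraidGroup n, pureBraidGroup n⁆

/-! ### Crystallographic and Bieberbach groups -/

/-- The group `ℝ^d ⋊ O(d)` of isometries of Euclidean space. -/
abbrev EuclideanIsometry (d : ℕ) : Type :=
  EuclideanSpace ℝ (Fin d) ≃ᵃⁱ[ℝ] EuclideanSpace ℝ (Fin d)

/-- The product topology of `ℝ^d × O(d)`: an isometry is recorded by its translation part (the
image of the origin) and its linear part. -/
instance euclideanIsometryTopology (d : ℕ) : TopologicalSpace (EuclideanIsometry d) :=
  TopologicalSpace.induced
    (fun a => (a 0, (a.linearIsometryEquiv.toContinuousLinearEquiv :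
      EuclideanSpace ℝ (Fin d) →L[ℝ] EuclideanSpace ℝ (Fin d))))
    inferInstance

/-- A discrete and uniform subgroup of `ℝ^d ⋊ O(d)`. -/
structure IsCrystallographicSubgroup {d : ℕ} (H : Subgroup (EuclideanIsometry d)) : Prop where
  discrete : DiscreteTopology H
  closed : IsClosed (H : Set (EuclideanIsometry d))
  uniform : CompactSpace (EuclideanIsometry d ⧸ H)

/-- `C` is (isomorphic to) a Bieberbach group of dimension `d`: a torsion free, discrete and
uniform subgroup of `ℝ^d ⋊ O(d)`. -/
structure IsBieberbachGroup (C : Type*) [Group C] (d : ℕ) : Prop where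
  crystallographic : ∃ f : C →* EuclideanIsometry d,
    Function.Injective f ∧ IsCrystallographicSubgroup f.range
  torsionFree : ∀ a : C, IsOfFinOrder a → a = 1

/-- `Φ` is the holonomy group of the crystallographic group `C` of dimension `d`: `Φ` is finite,
and there is a short exact sequence `0 → ℤ^d → C → Φ → 1` such that the action of `Φ` on `ℤ^d`
induced by conjugation in `C` is faithful, i.e. an element of `C` that centralizes the image
of `ℤ^d` maps to `1` in `Φ`. -/
def HasHolonomyGroup (C : Type*) [Group C] (d : ℕ) (Φ : Type*) [Group Φ] : Prop :=
  Finite Φ ∧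
  ∃ (ι : Multiplicative (Fin d → ℤ) →* C) (ζ : C →* Φ),
    Function.Injective ι ∧ ι.range = ζ.ker ∧ Function.Surjective ζ ∧
    ∀ a : C, (∀ x, a * ι x * a⁻¹ = ι x) → ζ a = 1

/-! ### Riemannian geometry in coordinates -/

section Riemannian

variable {d : ℕ} {M : Type} [TopologicalSpace M] [ChartedSpace (EuclideanSpace ℝ (Fin d)) M]
  [IsManifold (𝓡 d) ∞ M]

/-- A smooth Riemannian metric on the `d`-dimensional manifold `M`. -/
abbrev SmoothMetric (d : ℕ) (M : Type) [TopologicalSpace M]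
    [ChartedSpace (EuclideanSpace ℝ (Fin d)) M] [IsManifold (𝓡 d) ∞ M] : Type :=
  Bundle.ContMDiffRiemannianMetric (𝓡 d) ∞ (EuclideanSpace ℝ (Fin d))
    (fun x : M => TangentSpace (𝓡 d) x)

namespace SmoothMetric

variable (g : SmoothMetric d M) (φ : OpenPartialHomeomorph M (EuclideanSpace ℝ (Fin d)))

/-- The `i`-th coordinate vector field `∂_i` of the chart `φ`, at the point of `M` with
coordinates `y`. -/
def coordVec (y : EuclideanSpace ℝ (Fin d)) (i : Fin d) : TangentSpace (𝓡 d) (φ.symm y) :=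
  mfderiv (𝓡 d) (𝓡 d) φ.symm y (EuclideanSpace.single i (1 : ℝ) : EuclideanSpace ℝ (Fin d))

/-- The metric coefficients `g_{ij}` in the chart `φ`. -/
def gram (y : EuclideanSpace ℝ (Fin d)) : Matrix (Fin d) (Fin d) ℝ :=
  Matrix.of fun i j => g.inner (φ.symm y) (coordVec φ y i) (coordVec φ y j)

/-- The partial derivative `∂_i f` at `y`. -/
def partialDeriv (f : EuclideanSpace ℝ (Fin d) → ℝ) (i : Fin d)
    (y : EuclideanSpace ℝ (Fin d)) : ℝ :=
  fderiv ℝ f y (EuclideanSpace.single i (1 : ℝ))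

/-- The Christoffel symbol
`Γ^k_{ij} = 1/2 ∑_l g^{kl} (∂_i g_{jl} + ∂_j g_{il} - ∂_l g_{ij})` of the Levi-Civita connection
in the chart `φ`. -/
def christoffel (k i j : Fin d) (y : EuclideanSpace ℝ (Fin d)) : ℝ :=
  (1 / 2 : ℝ) * ∑ l : Fin d, (g.gram φ y)⁻¹ k l *
    (partialDeriv (fun z => g.gram φ z j l) i y + partialDeriv (fun z => g.gram φ z i l) j y
      - partialDeriv (fun z => g.gram φ z i j) l y)

/-- The component
`R^l_{kij} = ∂_i Γ^l_{jk} - ∂_j Γ^l_{ik} + ∑_m (Γ^l_{im} Γ^m_{jk} - Γ^l_{jm} Γ^m_{ik})` of the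
Riemann curvature tensor in the chart `φ`. -/
def curvature (l k i j : Fin d) (y : EuclideanSpace ℝ (Fin d)) : ℝ :=
  partialDeriv (g.christoffel φ l j k) i y - partialDeriv (g.christoffel φ l i k) j y
    + ∑ m : Fin d, (g.christoffel φ l i m y * g.christoffel φ m j k y
      - g.christoffel φ l j m y * g.christoffel φ m i k y)

/-- The metric is flat: its curvature vanishes at every point. -/
def IsFlat : Prop :=
  ∀ φ ∈ atlas (EuclideanSpace ℝ (Fin d)) M, ∀ y ∈ φ.target, ∀ l k i j : Fin d,
    g.curvature φ l k i j y = 0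

/-- The coordinates, in the chart `φ`, of a tangent vector at `x`. -/
def vecCoord (φ : OpenPartialHomeomorph M (EuclideanSpace ℝ (Fin d))) {x : M} (v : TangentSpace (𝓡 d) x) (k : Fin d) : ℝ :=
  WithLp.ofLp (show EuclideanSpace ℝ (Fin d) from mfderiv (𝓡 d) (𝓡 d) φ x v) k

/-- The vector field `V` along the curve `γ` is parallel on the interval `s` for the Levi-Civita
connection: in every chart, `dV^k/dt = - ∑_{i,j} Γ^k_{ij}(γ) (dγ^i/dt) V^j`. -/
def IsParallelAlong (γ : ℝ → M) (s : Set ℝ) (V : (t : ℝ) → TangentSpace (𝓡 d) (γ t)) : Prop :=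
  ∀ t ∈ s, ∀ φ ∈ atlas (EuclideanSpace ℝ (Fin d)) M, γ t ∈ φ.source → ∀ k : Fin d,
    HasDerivWithinAt (fun u => vecCoord φ (V u) k)
      (-∑ i : Fin d, ∑ j : Fin d, g.christoffel φ k i j (φ (γ t)) *
        derivWithin (fun u => φ (γ u) i) s t * vecCoord φ (V t) j) s t

/-- `A` is the parallel transport along the curve `γ`, followed from the parameter `a` to the
parameter `b` (where `b < a` is allowed: the curve is then followed backwards). -/
def IsTransportAlong (γ : ℝ → M) (a b : ℝ)
    (A : TangentSpace (𝓡 d) (γ a) ≃ₗ[ℝ] TangentSpace (𝓡 d) (γ b)) : Prop :=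
  ∀ v : TangentSpace (𝓡 d) (γ a), ∃ V : (t : ℝ) → TangentSpace (𝓡 d) (γ t),
    g.IsParallelAlong γ (Set.uIcc a b) V ∧ V a = v ∧ V b = A v

/-- `g.IsTransport p q A`: the isomorphism `A : T_p M → T_q M` is the parallel transport along
some piecewise `C^1` path from `p` to `q`, i.e. along a finite concatenation of `C^1` paths. -/
inductive IsTransport (g : SmoothMetric d M) (p : M) :
    (q : M) → (TangentSpace (𝓡 d) p ≃ₗ[ℝ] TangentSpace (𝓡 d) q) → Prop
  | refl : IsTransport g p p (LinearEquiv.refl ℝ (TangentSpace (𝓡 d) p))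
  | append (γ : ℝ → M) (a b : ℝ)
      (hγ : ContMDiffOn 𝓘(ℝ, ℝ) (𝓡 d) 1 γ (Set.uIcc a b))
      (A : TangentSpace (𝓡 d) p ≃ₗ[ℝ] TangentSpace (𝓡 d) (γ a))
      (B : TangentSpace (𝓡 d) (γ a) ≃ₗ[ℝ] TangentSpace (𝓡 d) (γ b))
      (hA : IsTransport g p (γ a) A) (hB : g.IsTransportAlong γ a b B) :
      IsTransport g p (γ b) (A.trans B)

variable {g}

theorem IsTransportAlong.symm {γ : ℝ → M} {a b : ℝ}
    {A : TangentSpace (𝓡 d) (γ a) ≃ₗ[ℝ] TangentSpace (𝓡 d) (γ b)}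
    (h : g.IsTransportAlong γ a b A) : g.IsTransportAlong γ b a A.symm := by
  intro v
  obtain ⟨V, hV, ha, hb⟩ := h (A.symm v)
  refine ⟨V, ?_, ?_, ha⟩
  · rwa [Set.uIcc_comm]
  · rw [hb, LinearEquiv.apply_symm_apply]

theorem IsTransport.trans {p q r : M}
    {A : TangentSpace (𝓡 d) p ≃ₗ[ℝ] TangentSpace (𝓡 d) q}
    {B : TangentSpace (𝓡 d) q ≃ₗ[ℝ] TangentSpace (𝓡 d) r}
    (hA : g.IsTransport p q A) (hB : g.IsTransport q r B) : g.IsTransport p r (A.trans B) := by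
  induction hB with
  | refl => exact hA
  | append γ a b hγ C D _ hD ih => exact IsTransport.append γ a b hγ (A.trans C) D ih hD

theorem IsTransport.symm {p q : M}
    {A : TangentSpace (𝓡 d) p ≃ₗ[ℝ] TangentSpace (𝓡 d) q}
    (hA : g.IsTransport p q A) : g.IsTransport q p A.symm := by
  induction hA with
  | refl => exact IsTransport.refl
  | append γ a b hγ C D _ hD ih =>
    have h := IsTransport.append γ b a (by rwa [Set.uIcc_comm])
      (LinearEquiv.refl ℝ _) D.symm IsTransport.refl hD.symm
    exact h.trans ih

variable (g)

/-- The holonomy group at `p`: the group of the parallel transports around the piecewise `C^1`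
loops based at `p`. -/
def holonomyGroup (p : M) : Subgroup (TangentSpace (𝓡 d) p ≃ₗ[ℝ] TangentSpace (𝓡 d) p) where
  carrier := {A | g.IsTransport p p A}
  one_mem' := IsTransport.refl
  mul_mem' := fun hA hB => IsTransport.trans hB hA
  inv_mem' := fun hA => IsTransport.symm hA

end SmoothMetric

end Riemannian

/-- A closed (compact, connected, without boundary) smooth Riemannian manifold of dimension `d`. -/
structure ClosedRiemannianManifold (d : ℕ) where
  carrier : Type
  [topology : TopologicalSpace carrier]
  [charts : ChartedSpace (EuclideanSpace ℝ (Fin d)) carrier]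
  [smooth : IsManifold (𝓡 d) ∞ carrier]
  [hausdorff : T2Space carrier]
  [secondCountable : SecondCountableTopology carrier]
  [compact : CompactSpace carrier]
  [connected : ConnectedSpace carrier]
  metric : SmoothMetric d carrier

attribute [instance] ClosedRiemannianManifold.topology ClosedRiemannianManifold.charts
  ClosedRiemannianManifold.smooth ClosedRiemannianManifold.hausdorff
  ClosedRiemannianManifold.secondCountable ClosedRiemannianManifold.compact
  ClosedRiemannianManifold.connected

end

/-! Send `σ_i` to the indicator of the pair `{i, i+1}` together with the transposition `(i, i+1)`.
This maps `B_n/[P_n, P_n]` to `ℤ^pairs ⋊ S_n`, with one coordinate for each of the `n(n-1)/2`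
unordered pairs; the integer at a pair counts the signed crossings of two strings. On `P_n/[P_n,
P_n]` the map is injective with image `2ℤ^pairs`. Indeed conjugates of the squares `σ_k²` give one
element per pair, whose crossing vector is twice a basis vector (`crossing_pairGen`). They generate
(`pure_le_pairSubgroup`), because killing them turns the braid relations into the Coxeter relations
of `S_n` (`CoxeterA.eq_one_of_map_eq_one`).

Write `G` as a product of cyclic groups `ℤ/m_i`, and let it act on `n` points by its regular
representation plus fixed points, reserving a marked pair of fixed points for each factor
(`exists_markedRep`). Let `Γ` consist of the elements over some `g` in `G` whose crossing number at
the `i`-th marked pair is `2k`, with `k` congruent modulo `m_i` to the `i`-th coordinate of `g`.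
Crossing numbers at a pair of fixed points are even (`toPair_mem_parity`), so they can be corrected
by pure braids and `Γ` maps onto `G`. If all marked crossings of an element vanish, its image in `G`
is trivial and it is a pure translation. Hence the permutation of every nontrivial element of `Γ`
fixes some pair with nonzero crossing number (`exists_crossing_ne_zero`).

Let `Γ` act on `ℝ^d`, `d = n(n-1)/2`, by permuting coordinates and translating by crossing numbers.
A nonzero integral shift of a fixed coordinate gives infinite order and displacement at least `1`
everywhere, and the pure part of `Γ` is a full lattice. So the action is free, properly
discontinuous and cocompact. The quotient is a closed flat manifold with fundamental group `Γ`.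
Parallel fields are constant upstairs, so its holonomy is the group of linear parts, which is `G`
because `S_n` acts faithfully on pairs for `n ≥ 3` (`OffDiag.eq_one_of_smul_eq`). -/

open scoped Manifold ContDiff

noncomputable section

/-! ### Quotients of Euclidean space by free discrete groups of isometries -/

/-- An action of the group `Γ` on `ℝ^d` by isometries, in which every nontrivial element moves
every point by a distance at least `1`, and in which some ball meets every orbit. -/
class FlatAction (Γ : Type) [Group Γ] (d : ℕ) where
  toIsometry : Γ →* EuclideanIsometry d
  one_le_dist : ∀ g : Γ, g ≠ 1 → ∀ x, 1 ≤ dist (toIsometry g x) x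
  exists_norm_le : ∃ C : ℝ, ∀ x, ∃ g : Γ, ‖toIsometry g x‖ ≤ C

namespace FlatAction

variable (Γ : Type) [Group Γ] (d : ℕ) [FlatAction Γ d]

instance mulAction : MulAction Γ (EuclideanSpace ℝ (Fin d)) where
  smul g x := toIsometry g x
  one_smul x := by
    change toIsometry (1 : Γ) x = x
    rw [map_one]; rfl
  mul_smul g h x := by
    change toIsometry (g * h) x = toIsometry g (toIsometry h x)
    rw [map_mul]; rfl

variable {Γ d}

theorem smul_def (g : Γ) (x : EuclideanSpace ℝ (Fin d)) : g • x = toIsometry g x := rfl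

instance : IsIsometricSMul Γ (EuclideanSpace ℝ (Fin d)) where
  isometry_smul g := (toIsometry g : EuclideanIsometry d).isometry

variable (d) in
/-- The linear part of the action of an element of the group. -/
def linearPart : Γ →* (EuclideanSpace ℝ (Fin d) ≃ₗᵢ[ℝ] EuclideanSpace ℝ (Fin d)) :=
  MonoidHom.comp
    { toFun a := a.linearIsometryEquiv
      map_one' := rfl
      map_mul' _ _ := rfl } (toIsometry : Γ →* EuclideanIsometry d)

theorem smul_eq (g : Γ) (x : EuclideanSpace ℝ (Fin d)) :
    g • x = linearPart d g x + g • (0 : EuclideanSpace ℝ (Fin d)) := by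
  have := (toIsometry g : EuclideanIsometry d).map_vadd 0 x
  simp only [vadd_eq_add, add_zero] at this
  exact this

theorem smul_eq' (g : Γ) : (fun x : EuclideanSpace ℝ (Fin d) => g • x) =
    fun x => linearPart d g x + g • (0 : EuclideanSpace ℝ (Fin d)) :=
  funext (smul_eq g)

theorem hasFDerivAt_smul (g : Γ) (x : EuclideanSpace ℝ (Fin d)) :
    HasFDerivAt (fun z : EuclideanSpace ℝ (Fin d) => g • z)
      (linearPart d g : EuclideanSpace ℝ (Fin d) →L[ℝ] EuclideanSpace ℝ (Fin d)) x := by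
  rw [smul_eq']
  exact ((linearPart d g).toContinuousLinearEquiv.hasFDerivAt).add_const _

theorem contDiff_smul (g : Γ) : ContDiff ℝ ∞ fun z : EuclideanSpace ℝ (Fin d) => g • z := by
  rw [smul_eq']
  exact (linearPart d g).contDiff.add contDiff_const

/-- The displacement bound for `h⁻¹ * g`: orbits are `1`-separated. Freeness, proper discontinuity,
and later discreteness and closedness of the group all rest on this. -/
theorem eq_of_dist_lt {g h : Γ} {x : EuclideanSpace ℝ (Fin d)} (hx : dist (g • x) (h • x) < 1) :
    g = h := by
  by_contra hne
  have h1 : h⁻¹ * g ≠ 1 := fun h1 => hne (by rwa [inv_mul_eq_one, eq_comm] at h1)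
  have h2 := one_le_dist (d := d) (h⁻¹ * g) h1 x
  rw [← smul_def, ← dist_smul h, smul_smul, mul_inv_cancel_left] at h2
  linarith

instance : IsCancelSMul Γ (EuclideanSpace ℝ (Fin d)) where
  right_cancel' g h x hx := eq_of_dist_lt (x := x) (by rw [hx, dist_self]; exact one_pos)

instance : ProperlyDiscontinuousSMul Γ (EuclideanSpace ℝ (Fin d)) where
  finite_disjoint_inter_image {K L} hK hL := by
    obtain ⟨s, -, hs, hKs⟩ := hK.finite_cover_balls (e := 1 / 4) (by norm_num)
    obtain ⟨t, -, ht, hLt⟩ := hL.finite_cover_balls (e := 1 / 4) (by norm_num)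
    -- With radius `1/4`, an element carrying a point of the ball at `x` into the ball at `y` moves
    -- `x` within `1/2` of `y`. Two such elements agree by `1`-separation, so each pair of centres
    -- accounts for at most one element.
    refine Set.Finite.subset (Set.Finite.biUnion hs fun x _ => Set.Finite.biUnion ht fun y _ =>
      (show Set.Finite {g : Γ | dist (g • x) y < 1 / 2} from
        Set.Subsingleton.finite fun g hg h hh => eq_of_dist_lt (x := x) ?_)) ?_
    · have := dist_triangle_right (g • x) (h • x) y
      simp only [Set.mem_ofPred_eq] at hg hh
      linarith
    · rintro g ⟨_, ⟨k, hk, rfl⟩, hl⟩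
      obtain ⟨x, hx, hkx⟩ := Set.mem_iUnion₂.1 (hKs hk)
      obtain ⟨y, hy, hly⟩ := Set.mem_iUnion₂.1 (hLt hl)
      refine Set.mem_biUnion hx (Set.mem_biUnion hy ?_)
      rw [Metric.mem_ball] at hkx hly
      change dist (g • k) y < 1 / 4 at hly
      have h1 := dist_triangle (g • x) (g • k) y
      rw [dist_smul, dist_comm x k] at h1
      simp only [Set.mem_ofPred_eq]
      linarith

/-! ### The quotient as a closed manifold -/

variable (Γ d)

/-- The quotient of `ℝ^d` by a flat action. -/
def Quot : Type := MulAction.orbitRel.Quotient Γ (EuclideanSpace ℝ (Fin d))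

instance : TopologicalSpace (Quot Γ d) :=
  inferInstanceAs (TopologicalSpace (MulAction.orbitRel.Quotient Γ (EuclideanSpace ℝ (Fin d))))

instance : T2Space (Quot Γ d) :=
  inferInstanceAs (T2Space (Quotient (MulAction.orbitRel Γ (EuclideanSpace ℝ (Fin d)))))

instance : SecondCountableTopology (Quot Γ d) :=
  ContinuousConstSMul.secondCountableTopology (Γ := Γ) (T := EuclideanSpace ℝ (Fin d))

/-- The projection of `ℝ^d` onto its quotient. -/
def proj : EuclideanSpace ℝ (Fin d) → Quot Γ d := Quotient.mk _

theorem isQuotientCoveringMap_proj : IsQuotientCoveringMap (proj Γ d) Γ :=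
  isQuotientCoveringMap_quotientMk_of_properlyDiscontinuousSMul

theorem isCoveringMap_proj : IsCoveringMap (proj Γ d) :=
  (isQuotientCoveringMap_proj Γ d).isCoveringMap

theorem continuous_proj : Continuous (proj Γ d) := (isCoveringMap_proj Γ d).continuous

theorem proj_surjective : Function.Surjective (proj Γ d) :=
  (isQuotientCoveringMap_proj Γ d).surjective

variable {d} in
theorem proj_smul (g : Γ) (x : EuclideanSpace ℝ (Fin d)) : proj Γ d (g • x) = proj Γ d x :=
  (isQuotientCoveringMap_proj Γ d).map_smul g

variable {Γ d} in
theorem proj_eq_proj {x y : EuclideanSpace ℝ (Fin d)} :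
    proj Γ d x = proj Γ d y ↔ ∃ g : Γ, g • y = x :=
  (isQuotientCoveringMap_proj Γ d).apply_eq_iff_mem_orbit

instance : ConnectedSpace (Quot Γ d) :=
  (proj_surjective Γ d).connectedSpace (continuous_proj Γ d)

instance : CompactSpace (Quot Γ d) := by
  obtain ⟨C, hC⟩ := exists_norm_le (Γ := Γ) (d := d)
  refine ⟨?_⟩
  have : (Set.univ : Set (Quot Γ d)) = proj Γ d '' Metric.closedBall 0 C := by
    refine (Set.eq_univ_of_forall fun q => ?_).symm
    obtain ⟨x, rfl⟩ := proj_surjective Γ d q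
    obtain ⟨g, hg⟩ := hC x
    exact ⟨g • x, by rwa [mem_closedBall_zero_iff], proj_smul Γ g x⟩
  rw [this]
  exact (isCompact_closedBall _ _).image (continuous_proj Γ d)

theorem nonempty_fundamentalGroup_mulEquiv (q : Quot Γ d) :
    Nonempty (FundamentalGroup (Quot Γ d) q ≃* Γ) := by
  obtain ⟨x, rfl⟩ := proj_surjective Γ d q
  -- As `ℝ^d` is simply connected, the covering identifies the fundamental group with the opposite
  -- of `Γ`; inversion turns it into `Γ`.
  exact ⟨((isQuotientCoveringMap_proj Γ d).fundamentalGroupEquiv ⟨x, rfl⟩).trans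
    (MulEquiv.inv' Γ).symm⟩

/-- The charts of the quotient are the local inverses of the projection. -/
instance : ChartedSpace (EuclideanSpace ℝ (Fin d)) (Quot Γ d) where
  atlas := {φ | φ.symm = proj Γ d}
  chartAt q := (isCoveringMap_proj Γ d).isLocalHomeomorph.localInverseAt
    (Function.surjInv (proj_surjective Γ d) q)
  mem_chart_source q := by
    have h := (isCoveringMap_proj Γ d).isLocalHomeomorph.apply_self_mem_localInverseAt_source
      (x := Function.surjInv (proj_surjective Γ d) q)
    rwa [Function.surjInv_eq (proj_surjective Γ d) q] at h
  chart_mem_atlas q := (isCoveringMap_proj Γ d).isLocalHomeomorph.localInverseAt_symm _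

variable {Γ d}
variable {φ ψ : OpenPartialHomeomorph (Quot Γ d) (EuclideanSpace ℝ (Fin d))}

theorem symm_eq_proj (hφ : φ ∈ atlas (EuclideanSpace ℝ (Fin d)) (Quot Γ d)) :
    φ.symm = proj Γ d := hφ

theorem proj_apply (hφ : φ ∈ atlas (EuclideanSpace ℝ (Fin d)) (Quot Γ d)) {q : Quot Γ d}
    (hq : q ∈ φ.source) : proj Γ d (φ q) = q := by
  rw [← symm_eq_proj hφ, φ.left_inv hq]

/-- In the charts, the projection is locally given by the action of an element of the group. -/
theorem exists_eventuallyEq_smul (hφ : φ ∈ atlas (EuclideanSpace ℝ (Fin d)) (Quot Γ d))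
    {y : EuclideanSpace ℝ (Fin d)} (hy : proj Γ d y ∈ φ.source) :
    ∃ g : Γ, φ (proj Γ d y) = g • y ∧ ∀ᶠ z in nhds y, φ (proj Γ d z) = g • z := by
  obtain ⟨g, hg⟩ := proj_eq_proj.1 (proj_apply hφ hy)
  refine ⟨g, hg.symm, ?_⟩
  have hmem : g • y ∈ φ.target := hg ▸ φ.map_source hy
  filter_upwards [(continuous_const_smul g).continuousAt.preimage_mem_nhds
    (φ.open_target.mem_nhds hmem)] with z hz
  rw [← proj_smul Γ g z, ← symm_eq_proj hφ, φ.right_inv hz]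

instance : IsManifold (𝓡 d) ∞ (Quot Γ d) := by
  refine isManifold_of_contDiffOn _ _ _ fun φ ψ hφ hψ => ?_
  simp only [modelWithCornersSelf_coe, modelWithCornersSelf_coe_symm, Function.comp_def, id,
    Set.range_id, Set.inter_univ, OpenPartialHomeomorph.coe_trans, symm_eq_proj hφ]
  rintro y ⟨-, hy⟩
  obtain ⟨g, -, hg⟩ := exists_eventuallyEq_smul hψ
    (show proj Γ d y ∈ ψ.source by rw [← symm_eq_proj hφ]; exact hy)
  exact ((contDiff_smul g).contDiffAt.congr_of_eventuallyEq hg).contDiffWithinAt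

end FlatAction

/-! ### Tangent maps and the flat metric -/

namespace FlatAction

variable {Γ : Type} [Group Γ] {d : ℕ} [FlatAction Γ d]

theorem linearPart_coe_inner (g : Γ) (v w : EuclideanSpace ℝ (Fin d)) :
    inner ℝ (linearPart d g v) (linearPart d g w) = inner ℝ v w :=
  (linearPart d g).inner_map_map v w

variable (Γ) in
/-- The element of the group by which the preferred chart at `proj y` differs from the
identity near `y`. -/
def frame (y : EuclideanSpace ℝ (Fin d)) : Γ :=
  (exists_eventuallyEq_smul (chart_mem_atlas (EuclideanSpace ℝ (Fin d)) (proj Γ d y))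
    (mem_chart_source _ (proj Γ d y))).choose

theorem chartAt_proj (y : EuclideanSpace ℝ (Fin d)) :
    chartAt (EuclideanSpace ℝ (Fin d)) (proj Γ d y) (proj Γ d y) = frame Γ y • y :=
  (exists_eventuallyEq_smul (chart_mem_atlas (EuclideanSpace ℝ (Fin d)) (proj Γ d y))
    (mem_chart_source _ (proj Γ d y))).choose_spec.1

theorem eventually_chartAt_proj (y : EuclideanSpace ℝ (Fin d)) :
    ∀ᶠ z in nhds y,
      chartAt (EuclideanSpace ℝ (Fin d)) (proj Γ d y) (proj Γ d z) = frame Γ y • z :=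
  (exists_eventuallyEq_smul (chart_mem_atlas (EuclideanSpace ℝ (Fin d)) (proj Γ d y))
    (mem_chart_source _ (proj Γ d y))).choose_spec.2

/-- Both points have the same projection, hence the same preferred chart; freeness does the rest.
This identity is what turns transport around a loop into a conjugate of a group element. -/
theorem frame_smul_mul (g : Γ) (y : EuclideanSpace ℝ (Fin d)) :
    frame Γ (g • y) * g = frame Γ y := by
  have h := chartAt_proj (Γ := Γ) (g • y)
  rw [proj_smul, chartAt_proj, ← mul_smul] at h
  exact (IsCancelSMul.right_cancel _ _ _ h).symm

variable {φ : OpenPartialHomeomorph (Quot Γ d) (EuclideanSpace ℝ (Fin d))}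

/-- The tangent space at a point is the model space read in the preferred chart there, and in that
chart the projection is the action of `frame Γ y` near `y`. -/
theorem mfderiv_proj (y : EuclideanSpace ℝ (Fin d)) (v : EuclideanSpace ℝ (Fin d)) :
    mfderiv (𝓡 d) (𝓡 d) (proj Γ d) y v = linearPart d (frame Γ y) v := by
  have h : HasMFDerivAt (𝓡 d) (𝓡 d) (proj Γ d) y
      (linearPart d (frame Γ y) : EuclideanSpace ℝ (Fin d) →L[ℝ] EuclideanSpace ℝ (Fin d)) := by
    refine ⟨(continuous_proj Γ d).continuousAt, HasFDerivAt.hasFDerivWithinAt ?_⟩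
    refine (hasFDerivAt_smul (frame Γ y) y).congr_of_eventuallyEq ?_
    filter_upwards [eventually_chartAt_proj (Γ := Γ) y] with z hz
    exact hz
  exact congrArg (fun L : EuclideanSpace ℝ (Fin d) →L[ℝ] EuclideanSpace ℝ (Fin d) => L v) h.mfderiv

theorem mfderiv_chart_symm (hφ : φ ∈ atlas (EuclideanSpace ℝ (Fin d)) (Quot Γ d))
    (y v : EuclideanSpace ℝ (Fin d)) :
    mfderiv (𝓡 d) (𝓡 d) φ.symm y v = linearPart d (frame Γ y) v := by
  have h : ∀ f, f = proj Γ d → mfderiv (𝓡 d) (𝓡 d) f y v = linearPart d (frame Γ y) v := by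
    rintro _ rfl
    exact mfderiv_proj y v
  exact h _ (symm_eq_proj hφ)

theorem mfderiv_chart (hφ : φ ∈ atlas (EuclideanSpace ℝ (Fin d)) (Quot Γ d))
    {y : EuclideanSpace ℝ (Fin d)} (hy : proj Γ d y ∈ φ.source) {g : Γ}
    (hg : φ (proj Γ d y) = g • y) (v : EuclideanSpace ℝ (Fin d)) :
    mfderiv (𝓡 d) (𝓡 d) φ (proj Γ d y) v = linearPart d (g * (frame Γ y)⁻¹) v := by
  have hp : proj Γ d (frame Γ y • y) = proj Γ d y := proj_smul Γ _ y
  obtain ⟨k, hk, hev⟩ := exists_eventuallyEq_smul hφ (y := frame Γ y • y) (by rwa [hp])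
  have hkg : k = g * (frame Γ y)⁻¹ := by
    rw [hp, hg, ← mul_smul] at hk
    rw [eq_mul_inv_iff_mul_eq]
    exact (IsCancelSMul.right_cancel _ _ _ hk).symm
  rw [hkg] at hev
  have h : HasMFDerivAt (𝓡 d) (𝓡 d) φ (proj Γ d y)
      (linearPart d (g * (frame Γ y)⁻¹) :
        EuclideanSpace ℝ (Fin d) →L[ℝ] EuclideanSpace ℝ (Fin d)) := by
    refine ⟨φ.continuousAt hy, HasFDerivAt.hasFDerivWithinAt ?_⟩
    refine (hasFDerivAt_smul (g * (frame Γ y)⁻¹) _).congr_of_eventuallyEq ?_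
    have := symm_eq_proj (chart_mem_atlas (EuclideanSpace ℝ (Fin d)) (proj Γ d y))
    simp only [mfld_simps, chartAt_proj, this, writtenInExtChartAt]
    filter_upwards [hev] with z hz
    exact hz
  exact congrArg (fun L : EuclideanSpace ℝ (Fin d) →L[ℝ] EuclideanSpace ℝ (Fin d) => L v) h.mfderiv

variable (Γ d)

/-- The euclidean inner product on the tangent spaces of the quotient. -/
def tangentInner (q : Quot Γ d) :
    TangentSpace (𝓡 d) q →L[ℝ] TangentSpace (𝓡 d) q →L[ℝ] ℝ :=
  (innerSL ℝ : EuclideanSpace ℝ (Fin d) →L[ℝ] EuclideanSpace ℝ (Fin d) →L[ℝ] ℝ)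

/-- The flat metric on the quotient. -/
def metric : SmoothMetric d (Quot Γ d) where
  inner := tangentInner Γ d
  symm _ v w := real_inner_comm (F := EuclideanSpace ℝ (Fin d)) _ _
  pos _ v hv := real_inner_self_pos (F := EuclideanSpace ℝ (Fin d)).2 hv
  isVonNBounded _ := by
    change Bornology.IsVonNBounded ℝ {v : EuclideanSpace ℝ (Fin d) | inner ℝ v v < 1}
    have : Metric.ball (0 : EuclideanSpace ℝ (Fin d)) 1 = {v | inner ℝ v v < 1} := by
      ext v
      rw [mem_ball_zero_iff, Set.mem_ofPred_eq, real_inner_self_eq_norm_sq, sq_lt_one_iff₀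
        (norm_nonneg v)]
    rw [← this]
    exact NormedSpace.isVonNBounded_ball ℝ _ 1
  contMDiff := by
    intro q₀
    rw [Bundle.contMDiffAt_section]
    -- Trivializing the tangent bundle at `q₀` changes vectors by orthogonal linear parts, so the
    -- metric is locally the constant form `B`.
    let B : EuclideanSpace ℝ (Fin d) →L[ℝ] EuclideanSpace ℝ (Fin d) →L[ℝ] ℝ := innerSL ℝ
    refine (contMDiffAt_const (c := B)).congr_of_eventuallyEq ?_
    have hatl := chart_mem_atlas (EuclideanSpace ℝ (Fin d)) q₀
    filter_upwards [(chartAt (EuclideanSpace ℝ (Fin d)) q₀).open_source.mem_nhds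
      (mem_chart_source _ q₀)] with q hq
    have key : ∀ v : EuclideanSpace ℝ (Fin d),
        (trivializationAt (EuclideanSpace ℝ (Fin d)) (TangentSpace (𝓡 d)) q₀).symm q v =
          linearPart d (frame Γ (chartAt (EuclideanSpace ℝ (Fin d)) q₀ q)) v := by
      intro v
      have h := TangentBundle.symmL_trivializationAt (I := 𝓡 d) (x₀ := q₀) hq
      simp only [modelWithCornersSelf_coe, Set.range_id, mfderivWithin_univ, mfld_simps]
        at h
      have h2 := congrArg
        (fun L : EuclideanSpace ℝ (Fin d) →L[ℝ] EuclideanSpace ℝ (Fin d) => L v) h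
      exact (Bundle.Trivialization.symmL_apply (R := ℝ) _ (by simpa using hq) v).symm.trans
        (h2.trans (mfderiv_chart_symm hatl _ v))
    ext v w
    rw [hom_trivializationAt_apply, inCoordinates_apply_eq₂ (by simpa using hq) (by simpa using hq)
      (by simp)]
    rw [key v, key w]
    exact (LinearMap.congr_fun (Bundle.Trivial.linearMapAt_trivialization ℝ (Quot Γ d) ℝ q) _).trans
      (linearPart_coe_inner _ v w)

end FlatAction

/-! ### Flatness, parallel transport and holonomy -/

namespace FlatAction

variable {Γ : Type} [Group Γ] {d : ℕ} [FlatAction Γ d]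
variable {φ : OpenPartialHomeomorph (Quot Γ d) (EuclideanSpace ℝ (Fin d))}

theorem gram_metric (hφ : φ ∈ atlas (EuclideanSpace ℝ (Fin d)) (Quot Γ d))
    (y : EuclideanSpace ℝ (Fin d)) : (metric Γ d).gram φ y = 1 := by
  ext i j
  have h : (metric Γ d).gram φ y i j =
      inner ℝ (linearPart d (frame Γ y) (EuclideanSpace.single i (1 : ℝ)))
        (linearPart d (frame Γ y) (EuclideanSpace.single j (1 : ℝ))) := by
    rw [← mfderiv_chart_symm hφ, ← mfderiv_chart_symm hφ]
    rfl
  rw [h, linearPart_coe_inner, EuclideanSpace.inner_single_left, Matrix.one_apply]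
  simp

theorem christoffel_metric (hφ : φ ∈ atlas (EuclideanSpace ℝ (Fin d)) (Quot Γ d))
    (k i j : Fin d) : (metric Γ d).christoffel φ k i j = 0 := by
  ext y
  simp [SmoothMetric.christoffel, SmoothMetric.partialDeriv, gram_metric hφ]

theorem isFlat_metric : (metric Γ d).IsFlat := by
  intro φ hφ y _ l k i j
  simp [SmoothMetric.curvature, SmoothMetric.partialDeriv, christoffel_metric hφ]

theorem vecCoord_eq (hφ : φ ∈ atlas (EuclideanSpace ℝ (Fin d)) (Quot Γ d))
    {y : EuclideanSpace ℝ (Fin d)} {q : Quot Γ d} (hy : proj Γ d y = q) (hq : q ∈ φ.source)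
    {g : Γ} (hg : φ q = g • y) (v : EuclideanSpace ℝ (Fin d)) (k : Fin d) :
    SmoothMetric.vecCoord φ (show TangentSpace (𝓡 d) q from v) k =
      linearPart d (g * (frame Γ y)⁻¹) v k := by
  subst hy
  rw [← mfderiv_chart hφ hq hg]
  rfl

/-- Parallel fields along a curve are the fields which are constant in the frame carried along
a lift of the curve. -/
theorem isParallelAlong_iff {γ : ℝ → Quot Γ d} {c : ℝ → EuclideanSpace ℝ (Fin d)} {s : Set ℝ}
    (hc : ContinuousOn c s) (hγ : ∀ t ∈ s, proj Γ d (c t) = γ t)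
    (V : ℝ → EuclideanSpace ℝ (Fin d)) :
    (metric Γ d).IsParallelAlong γ s (fun t => show TangentSpace (𝓡 d) (γ t) from V t) ↔
      ∀ t ∈ s, HasFDerivWithinAt (fun u => linearPart d (frame Γ (c u))⁻¹ (V u))
        (0 : ℝ →L[ℝ] EuclideanSpace ℝ (Fin d)) s t := by
  -- Near `t`, the coordinates of `V` in `φ` are a fixed orthogonal map applied to `V` pulled back
  -- by the frame. The Christoffel symbols being zero, the parallel equation says exactly that these
  -- coordinates have zero derivative.
  have key : ∀ t ∈ s, ∀ φ ∈ atlas (EuclideanSpace ℝ (Fin d)) (Quot Γ d), γ t ∈ φ.source →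
      ((∀ k : Fin d, HasDerivWithinAt (fun u => SmoothMetric.vecCoord φ
        (show TangentSpace (𝓡 d) (γ u) from V u) k) 0 s t) ↔
      HasFDerivWithinAt (fun u => linearPart d (frame Γ (c u))⁻¹ (V u))
        (0 : ℝ →L[ℝ] EuclideanSpace ℝ (Fin d)) s t) := by
    intro t ht φ hφ hφt
    obtain ⟨g, -, hg⟩ := exists_eventuallyEq_smul hφ (y := c t) (by rwa [hγ t ht])
    have hs : ∀ᶠ z in nhds (c t), proj Γ d z ∈ φ.source :=
      (continuous_proj Γ d).continuousAt.preimage_mem_nhds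
        (φ.open_source.mem_nhds (by rwa [hγ t ht]))
    have hev : ∀ᶠ u in nhdsWithin t s, ∀ k, SmoothMetric.vecCoord φ
        (show TangentSpace (𝓡 d) (γ u) from V u) k =
          linearPart d g (linearPart d (frame Γ (c u))⁻¹ (V u)) k := by
      filter_upwards [(hc t ht).eventually hg, (hc t ht).eventually hs, self_mem_nhdsWithin]
        with u h1 h2 hu k
      rw [hγ u hu] at h1 h2
      rw [vecCoord_eq hφ (hγ u hu) h2 h1, map_mul]
      rfl
    have hgW : HasFDerivWithinAt (fun u => linearPart d (frame Γ (c u))⁻¹ (V u))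
        (0 : ℝ →L[ℝ] EuclideanSpace ℝ (Fin d)) s t ↔
        HasFDerivWithinAt (fun u => linearPart d g (linearPart d (frame Γ (c u))⁻¹ (V u)))
        (0 : ℝ →L[ℝ] EuclideanSpace ℝ (Fin d)) s t := by
      have := (linearPart d g).toContinuousLinearEquiv.comp_hasFDerivWithinAt_iff (s := s) (x := t)
        (f := fun u => linearPart d (frame Γ (c u))⁻¹ (V u))
        (f' := (0 : ℝ →L[ℝ] EuclideanSpace ℝ (Fin d)))
      rw [ContinuousLinearMap.comp_zero] at this
      exact this.symm
    rw [hgW, hasFDerivWithinAt_euclidean]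
    refine forall_congr' fun k => ?_
    rw [ContinuousLinearMap.comp_zero, hasDerivWithinAt_iff_hasFDerivWithinAt,
      ContinuousLinearMap.toSpanSingleton_zero]
    have hk : (fun u => SmoothMetric.vecCoord φ (show TangentSpace (𝓡 d) (γ u) from V u) k)
        =ᶠ[nhdsWithin t s] fun u => linearPart d g (linearPart d (frame Γ (c u))⁻¹ (V u)) k :=
      hev.mono fun u hu => hu k
    exact hk.hasFDerivWithinAt_iff_of_mem ht
  constructor
  · intro h t ht
    refine (key t ht _ (chart_mem_atlas _ (γ t)) (mem_chart_source _ (γ t))).1 fun k => ?_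
    simpa [christoffel_metric (chart_mem_atlas _ (γ t))] using
      h t ht _ (chart_mem_atlas _ (γ t)) (mem_chart_source _ (γ t)) k
  · intro h t ht φ hφ hφt k
    simpa [christoffel_metric hφ] using (key t ht φ hφ hφt).2 (h t ht) k

theorem exists_lift {γ : ℝ → Quot Γ d} {a b : ℝ} (hγ : ContinuousOn γ (Set.uIcc a b))
    {x : EuclideanSpace ℝ (Fin d)} (hx : proj Γ d x = γ a) :
    ∃ c : ℝ → EuclideanSpace ℝ (Fin d), Continuous c ∧ c a = x ∧
      ∀ t ∈ Set.uIcc a b, proj Γ d (c t) = γ t := by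
  let δ : C(unitInterval, Quot Γ d) :=
    ⟨fun t => γ (AffineMap.lineMap a b (t : ℝ)), hγ.comp_continuous (by fun_prop) fun t => by
      rw [← segment_eq_uIcc, segment_eq_image_lineMap]
      exact ⟨t, t.2, rfl⟩⟩
  have h0 : δ 0 = proj Γ d x := by simp [δ, hx]
  let c := (isCoveringMap_proj Γ d).liftPath δ x h0
  have hc : ∀ t, proj Γ d (c t) = δ t :=
    fun t => congrFun ((isCoveringMap_proj Γ d).liftPath_lifts δ x h0) t
  -- Clamping extends the lift by constants outside the interval. If `a = b`, division by zero gives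
  -- `0` and the lift is constantly `x`.
  refine ⟨fun u => c (Set.projIcc 0 1 zero_le_one ((u - a) / (b - a))),
    c.continuous.comp (continuous_projIcc.comp (by fun_prop)), ?_, fun t ht => ?_⟩
  · simpa using (isCoveringMap_proj Γ d).liftPath_zero δ x h0
  · rw [← segment_eq_uIcc, segment_eq_image_lineMap] at ht
    obtain ⟨s, hs, rfl⟩ := ht
    rw [hc]
    by_cases hab : a = b
    · subst hab
      simp [δ]
    · have : (AffineMap.lineMap a b s - a) / (b - a) = s := by
        rw [AffineMap.lineMap_apply_module', add_sub_cancel_right, smul_eq_mul,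
          mul_div_cancel_right₀ _ (sub_ne_zero.2 (Ne.symm hab))]
      rw [this, Set.projIcc_of_mem zero_le_one hs]
      rfl

theorem exists_of_isTransportAlong {γ : ℝ → Quot Γ d} {a b : ℝ}
    (hγ : ContinuousOn γ (Set.uIcc a b)) {x : EuclideanSpace ℝ (Fin d)} (hx : proj Γ d x = γ a)
    {B : TangentSpace (𝓡 d) (γ a) ≃ₗ[ℝ] TangentSpace (𝓡 d) (γ b)}
    (hB : (metric Γ d).IsTransportAlong γ a b B) :
    ∃ y, proj Γ d y = γ b ∧
      ∀ v : EuclideanSpace ℝ (Fin d), B v = linearPart d (frame Γ y * (frame Γ x)⁻¹) v := by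
  obtain ⟨c, hc, rfl, hcγ⟩ := exists_lift hγ hx
  refine ⟨c b, hcγ b Set.right_mem_uIcc, fun v => ?_⟩
  obtain ⟨V, hV, hVa, hVb⟩ := hB v
  have h := (isParallelAlong_iff (d := d) hc.continuousOn hcγ V).1 hV
  have h2 := (convex_uIcc a b).norm_image_sub_le_of_norm_hasFDerivWithin_le (C := 0) h
    (fun _ _ => by simp) Set.left_mem_uIcc Set.right_mem_uIcc
  rw [zero_mul, norm_le_zero_iff, sub_eq_zero] at h2
  have h3 : ∀ w, linearPart d (frame Γ (c b)) (linearPart d (frame Γ (c b))⁻¹ w) = w := fun w => by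
    rw [map_inv, LinearIsometryEquiv.inv_def, LinearIsometryEquiv.apply_symm_apply]
  rw [← hVb, map_mul]
  refine (h3 _).symm.trans ((congrArg _ h2).trans ?_)
  rw [hVa]
  rfl

/-- Lift the pieces successively, each from the endpoint of the previous lift; the frames at
intermediate points telescope. -/
theorem exists_of_isTransport {x : EuclideanSpace ℝ (Fin d)} {p q : Quot Γ d}
    {A : TangentSpace (𝓡 d) p ≃ₗ[ℝ] TangentSpace (𝓡 d) q} (hp : proj Γ d x = p)
    (hA : (metric Γ d).IsTransport p q A) :
    ∃ y, proj Γ d y = q ∧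
      ∀ v : EuclideanSpace ℝ (Fin d), A v = linearPart d (frame Γ y * (frame Γ x)⁻¹) v := by
  induction hA with
  | refl => exact ⟨x, hp, fun v => by rw [mul_inv_cancel, map_one]; rfl⟩
  | append γ a b hγ A B _ hB ih =>
    obtain ⟨y, hy, hA⟩ := ih
    obtain ⟨z, hz, hB⟩ := exists_of_isTransportAlong hγ.continuousOn hy hB
    refine ⟨z, hz, fun v => (congrArg B (hA v)).trans ((hB _).trans ?_)⟩
    rw [show frame Γ z * (frame Γ x)⁻¹ =
      frame Γ z * (frame Γ y)⁻¹ * (frame Γ y * (frame Γ x)⁻¹) by group, map_mul _ (_ * _) (_ * _)]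
    rfl

theorem exists_isTransport (x y : EuclideanSpace ℝ (Fin d)) {p q : Quot Γ d}
    (hp : proj Γ d x = p) (hq : proj Γ d y = q) :
    ∃ A : TangentSpace (𝓡 d) p ≃ₗ[ℝ] TangentSpace (𝓡 d) q, (metric Γ d).IsTransport p q A ∧
      ∀ v : EuclideanSpace ℝ (Fin d), A v = linearPart d (frame Γ y * (frame Γ x)⁻¹) v := by
  let c : ℝ → EuclideanSpace ℝ (Fin d) := AffineMap.lineMap x y
  have h0 : c 0 = x := AffineMap.lineMap_apply_zero x y
  have h1 : c 1 = y := AffineMap.lineMap_apply_one x y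
  have hc : ContDiff ℝ 1 c := by
    have : c = fun t => t • (y - x) + x := funext fun t => AffineMap.lineMap_apply_module' x y t
    rw [this]
    fun_prop
  -- Once `c` is opaque, `x` and `y` can be replaced by `c 0` and `c 1`.
  clear_value c
  subst h0 h1 hp hq
  let B : TangentSpace (𝓡 d) (proj Γ d (c 0)) ≃ₗ[ℝ] TangentSpace (𝓡 d) (proj Γ d (c 1)) :=
    (linearPart d (frame Γ (c 1) * (frame Γ (c 0))⁻¹)).toLinearEquiv
  have hproj : ContMDiff (𝓡 d) (𝓡 d) 1 (proj Γ d) := by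
    intro z
    have h := (isCoveringMap_proj Γ d).isLocalHomeomorph.localInverseAt_symm z
    rw [← h]
    refine (contMDiffOn_symm_of_mem_maximalAtlas (I := 𝓡 d) (n := 1) ?_).contMDiffAt
      (((isCoveringMap_proj Γ d).isLocalHomeomorph.localInverseAt z).open_target.mem_nhds
      (isCoveringMap_proj Γ d).isLocalHomeomorph.self_mem_localInverseAt_target)
    exact IsManifold.subset_maximalAtlas h
  refine ⟨(LinearEquiv.refl ℝ _).trans B, SmoothMetric.IsTransport.append (fun t => proj Γ d (c t))
    0 1 (hproj.comp hc.contMDiff).contMDiffOn _ B SmoothMetric.IsTransport.refl fun v => ?_,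
    fun v => rfl⟩
  let V : ℝ → EuclideanSpace ℝ (Fin d) :=
    fun t => linearPart d (frame Γ (c t) * (frame Γ (c 0))⁻¹) v
  refine ⟨V, (isParallelAlong_iff (d := d) (c := c) hc.continuous.continuousOn
    (fun _ _ => rfl) V).2 fun t _ => ?_, ?_, rfl⟩
  · have : (fun u => linearPart d (frame Γ (c u))⁻¹ (V u)) =
        fun _ => linearPart d (frame Γ (c 0))⁻¹ v := by
      ext1 u
      rw [show (frame Γ (c 0))⁻¹ = (frame Γ (c u))⁻¹ * (frame Γ (c u) * (frame Γ (c 0))⁻¹) by group,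
        map_mul _ _ (_ * _)]
      rfl
    rw [this]
    exact hasFDerivWithinAt_const _ _ _
  · change linearPart d (frame Γ (c 0) * (frame Γ (c 0))⁻¹) v = v
    rw [mul_inv_cancel, map_one]
    rfl

variable (Γ) in
/-- The parallel transports around the loops at `proj x`. -/
def transportHom (x : EuclideanSpace ℝ (Fin d)) :
    Γ →* (TangentSpace (𝓡 d) (proj Γ d x) ≃ₗ[ℝ] TangentSpace (𝓡 d) (proj Γ d x)) where
  toFun g := (linearPart d (MulAut.conj (frame Γ x) g)).toLinearEquiv
  map_one' := by rw [map_one, map_one]; rfl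
  map_mul' g h := by rw [map_mul, map_mul]; rfl

/-- A loop at `proj x` lifts to a path from `x` to some `g • x`, and its transport is the linear
part of `frame (g • x) * (frame x)⁻¹`, the conjugate of `g⁻¹` by the frame at `x`. Conversely a
segment from `x` to `g⁻¹ • x` realizes `g`. -/
theorem range_transportHom (x : EuclideanSpace ℝ (Fin d)) :
    (transportHom Γ x).range = (metric Γ d).holonomyGroup (proj Γ d x) := by
  ext A
  constructor
  · rintro ⟨g, rfl⟩
    obtain ⟨A, hA, hAv⟩ := exists_isTransport x (g⁻¹ • x) rfl (proj_smul Γ g⁻¹ x)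
    have : transportHom Γ x g = A := by
      refine LinearEquiv.ext fun v => ((hAv v).trans ?_).symm
      rw [eq_mul_inv_iff_mul_eq.2 (frame_smul_mul g⁻¹ x)]
      refine congrArg (fun h => linearPart d h v) ?_
      rw [MulAut.conj_apply]
      group
    rw [this]
    exact hA
  · intro hA
    obtain ⟨y, hy, hAv⟩ := exists_of_isTransport rfl hA
    obtain ⟨g, rfl⟩ := proj_eq_proj.1 hy
    refine ⟨g⁻¹, LinearEquiv.ext fun v => ((hAv v).trans ?_).symm⟩
    rw [eq_mul_inv_iff_mul_eq.2 (frame_smul_mul g x)]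
    refine congrArg (fun h => linearPart d h v) ?_
    rw [MulAut.conj_apply]

theorem nonempty_holonomyGroup_mulEquiv {G : Type*} [Group G] {ζ : Γ →* G}
    (hζ : Function.Surjective ζ) (hker : ∀ g, linearPart d g = 1 ↔ ζ g = 1) (q : Quot Γ d) :
    Nonempty ((metric Γ d).holonomyGroup q ≃* G) := by
  obtain ⟨x, rfl⟩ := proj_surjective Γ d q
  have hk : (transportHom Γ x).ker = ζ.ker := by
    ext g
    rw [MonoidHom.mem_ker, MonoidHom.mem_ker, ← hker]
    have h1 : transportHom Γ x g = 1 ↔ linearPart d (MulAut.conj (frame Γ x) g) = 1 :=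
      ⟨fun h => LinearIsometryEquiv.ext fun v => LinearEquiv.congr_fun h v,
        fun h => LinearEquiv.ext fun v => congrArg (fun L => L v) h⟩
    rw [h1, MulAut.conj_apply, map_mul, map_mul, map_inv, mul_inv_eq_one, mul_eq_left]
  rw [← range_transportHom]
  exact ⟨(QuotientGroup.quotientKerEquivRange _).symm.trans
    ((QuotientGroup.quotientMulEquivOfEq hk).trans
      (QuotientGroup.quotientKerEquivOfSurjective ζ hζ))⟩

variable (Γ d) in
/-- The quotient of `ℝ^d` by a flat action, as a closed Riemannian manifold. -/
def closedManifold : ClosedRiemannianManifold d where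
  carrier := Quot Γ d
  metric := metric Γ d

end FlatAction

/-! ### The Coxeter presentation of the symmetric group -/

namespace CoxeterA

variable {K : Type*} [Group K] (s : ℕ → K)

/-- The product `s (j + l - 1) * ⋯ * s j`. -/
def descending (j : ℕ) : ℕ → K
  | 0 => 1
  | l + 1 => s (j + l) * descending j l

theorem descending_succ' (j l : ℕ) : descending s j (l + 1) = descending s (j + 1) l * s j := by
  induction l with
  | zero => simp [descending]
  | succ l ih => rw [descending, ih, descending, mul_assoc, Nat.add_right_comm, Nat.add_assoc]

/-- The relations of the Coxeter group of type `A`, for the generators `s 0, …, s (m - 1)`. -/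
structure Relations (m : ℕ) : Prop where
  sq : ∀ i < m, s i * s i = 1
  braid : ∀ i, i + 1 < m → s (i + 1) * s i * s (i + 1) = s i * s (i + 1) * s i
  comm : ∀ i j, i + 2 ≤ j → j < m → s i * s j = s j * s i

variable {s} {m : ℕ} (hs : Relations s m)
include hs

theorem descending_comm {i j l : ℕ} (hl : j + l ≤ m) (hi : i < m)
    (h : i + 2 ≤ j ∨ j + l + 1 ≤ i) :
    descending s j l * s i = s i * descending s j l := by
  induction l with
  | zero => simp [descending]
  | succ l ih =>
    have hcomm : s (j + l) * s i = s i * s (j + l) := by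
      rcases h with h | h
      · exact (hs.comm _ _ (by omega) (by omega)).symm
      · exact hs.comm _ _ (by omega) hi
    rw [descending, mul_assoc, ih (by omega) (by omega), ← mul_assoc, hcomm, mul_assoc]

/-- The generator commutes past the lower factors, the braid relation lowers its index by one, and
the result commutes past the upper factors. -/
theorem descending_mul_of_mem {i j l : ℕ} (hl : j + l ≤ m) (h1 : j ≤ i) (h2 : i + 1 < j + l) :
    descending s j l * s (i + 1) = s i * descending s j l := by
  induction l with
  | zero => omega
  | succ l ih =>
    rcases Nat.lt_or_ge (i + 1) (j + l) with h | h
    · rw [descending, mul_assoc, ih (by omega) h, ← mul_assoc, ← mul_assoc,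
        hs.comm i (j + l) (by omega) (by omega)]
    · obtain ⟨l, rfl⟩ : ∃ l', l = l' + 1 := ⟨l - 1, by omega⟩
      have hi : i = j + l := by omega
      subst hi
      rw [descending, descending, mul_assoc, mul_assoc,
        descending_comm hs (by omega) (by omega) (Or.inr (by omega)), ← mul_assoc, ← mul_assoc,
        show j + (l + 1) = j + l + 1 from rfl, hs.braid _ (by omega), mul_assoc, mul_assoc]

/-- The descending products ending at `s k`, with the empty one, meet all cosets of the subgroup
generated by `s 0, …, s (k - 1)`. The set of such products is stable under right multiplication by
`s i`: this generator is absorbed on the left if `i + 1 < j` or `i > j`, lengthens the product if `i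
+ 1 = j`, and cancels if `i = j`. -/
theorem exists_eq_mul_descending {k : ℕ} (hk : k < m) {x : K}
    (hx : x ∈ Subgroup.closure (s '' Set.Iio (k + 1))) :
    ∃ h ∈ Subgroup.closure (s '' Set.Iio k), ∃ j l, j + l = k + 1 ∧ x = h * descending s j l := by
  have step : ∀ x, ∀ i < k + 1, (∃ h ∈ Subgroup.closure (s '' Set.Iio k), ∃ j l,
      j + l = k + 1 ∧ x = h * descending s j l) → ∃ h ∈ Subgroup.closure (s '' Set.Iio k),
      ∃ j l, j + l = k + 1 ∧ x * s i = h * descending s j l := by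
    rintro _ i hi ⟨h, hh, j, l, hjl, rfl⟩
    rcases Nat.lt_or_ge (i + 1) j with hij | hij
    · refine ⟨h * s i, mul_mem hh (Subgroup.subset_closure ⟨i, by simp; omega, rfl⟩), j, l, hjl, ?_⟩
      rw [mul_assoc, mul_assoc, descending_comm hs (by omega) (by omega) (Or.inl (by omega))]
    rcases hij.eq_or_lt with hij | hij
    · subst hij
      exact ⟨h, hh, i, l + 1, by omega, by rw [descending_succ', mul_assoc]⟩
    rcases (Nat.lt_succ_iff.1 hij).eq_or_lt with hij | hij
    · subst hij
      obtain ⟨l, rfl⟩ : ∃ l', l = l' + 1 := ⟨l - 1, by omega⟩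
      refine ⟨h, hh, j + 1, l, by omega, ?_⟩
      rw [descending_succ', mul_assoc, mul_assoc, hs.sq j (by omega), mul_one]
    · obtain ⟨i, rfl⟩ : ∃ i', i = i' + 1 := ⟨i - 1, by omega⟩
      refine ⟨h * s i, mul_mem hh (Subgroup.subset_closure ⟨i, by simp; omega, rfl⟩), j, l, hjl, ?_⟩
      rw [mul_assoc, mul_assoc, descending_mul_of_mem hs (by omega) (by omega) (by omega)]
  refine Subgroup.closure_induction_right ⟨1, one_mem _, k + 1, 0, rfl, by simp [descending]⟩ ?_ ?_ hx
  · rintro x - _ ⟨i, hi, rfl⟩ h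
    exact step x i hi h
  · rintro x - _ ⟨i, hi, rfl⟩ h
    rw [inv_eq_of_mul_eq_one_left (hs.sq i (lt_of_lt_of_le hi (by omega)))]
    exact step x i hi h

/-- A group generated by elements satisfying the Coxeter relations of type `A` which maps to a
symmetric group, the generators being sent to adjacent transpositions, does so injectively. -/
theorem eq_one_of_map_eq_one {α : Type*} [DecidableEq α] {p : ℕ → α}
    (hp : Set.InjOn p (Set.Iic m)) (f : K →* Equiv.Perm α)
    (hf : ∀ i < m, f (s i) = Equiv.swap (p i) (p (i + 1))) {k : ℕ} (hk : k ≤ m) {x : K}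
    (hx : x ∈ Subgroup.closure (s '' Set.Iio k)) (hfx : f x = 1) : x = 1 := by
  induction k generalizing x with
  | zero => simpa [Set.Iio] using hx
  | succ k ih =>
    have hp' : ∀ i j, i ≤ m → j ≤ m → i ≠ j → p i ≠ p j := fun i j hi hj hij h => hij (hp hi hj h)
    obtain ⟨h, hh, j, l, hjl, rfl⟩ := exists_eq_mul_descending hs (by omega) hx
    have h1 : ∀ l, j + l ≤ m → f (descending s j l) (p j) = p (j + l) := by
      intro l hl
      induction l with
      | zero => simp [descending]
      | succ l ih =>
        rw [descending, map_mul, Equiv.Perm.mul_apply, ih (by omega), hf _ (by omega),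
          Equiv.swap_apply_left]
        rfl
    have h2 : f h (p (k + 1)) = p (k + 1) := by
      have : Subgroup.closure (s '' Set.Iio k) ≤
          (MulAction.stabilizer (Equiv.Perm α) (p (k + 1))).comap f := by
        rw [Subgroup.closure_le]
        rintro _ ⟨i, hi, rfl⟩
        have hi' : i < k := hi
        change f (s i) (p (k + 1)) = p (k + 1)
        rw [hf _ (by omega), Equiv.swap_apply_of_ne_of_ne] <;>
          exact hp' _ _ (by omega) (by omega) (by omega)
      exact this hh
    -- The descending product carries `p j` to `p (k + 1)`, which `f h` fixes. A trivial image thus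
    -- forces the descending product to be empty, and the induction applies to `h`.
    have h3 : p (k + 1) = p j := by
      have := DFunLike.congr_fun hfx (p j)
      rwa [map_mul, Equiv.Perm.mul_apply, h1 l (by omega), hjl, h2] at this
    have h4 : k + 1 = j := hp (Set.mem_Iic.2 (by omega)) (Set.mem_Iic.2 (by omega)) h3
    obtain rfl : l = 0 := by omega
    rw [descending, mul_one] at hfx ⊢
    exact ih (by omega) hh hfx

end CoxeterA

/-! ### Families indexed by pairs -/

namespace PairFamily

variable {X : Type*} (c : ℕ → X → X) (a : ℕ → X)

/-- The element attached to the pair `{i, i + l + 1}`. -/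
def ascending (i : ℕ) : ℕ → X
  | 0 => a i
  | l + 1 => c (i + l + 1) (ascending i l)

/-- The relations satisfied by the operators `c k` of conjugation by the braid generators and by
the squares `a k` of these generators, modulo commutators of pure braids. -/
structure Relations (m : ℕ) : Prop where
  invol : ∀ k < m, ∀ x, c k (c k x) = x
  braid : ∀ k, k + 1 < m → ∀ x, c (k + 1) (c k (c (k + 1) x)) = c k (c (k + 1) (c k x))
  comm : ∀ i j, i + 2 ≤ j → j < m → ∀ x, c i (c j x) = c j (c i x)
  fix : ∀ k < m, c k (a k) = a k
  fix_left : ∀ i j, i + 2 ≤ j → j < m → c i (a j) = a j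
  fix_right : ∀ i j, i + 2 ≤ j → j < m → c j (a i) = a i
  move : ∀ k, k + 1 < m → c k (a (k + 1)) = c (k + 1) (a k)

variable {c a} {m : ℕ} (h : Relations c a m)
include h

theorem apply_ascending_of_far {i l k : ℕ} (hl : i + l < m) (hk : k < m)
    (hki : k + 2 ≤ i ∨ i + l + 2 ≤ k) : c k (ascending c a i l) = ascending c a i l := by
  induction l with
  | zero =>
    rcases hki with hki | hki
    · exact h.fix_left _ _ hki hl
    · exact h.fix_right _ _ hki hk
  | succ l ih =>
    have hcomm : ∀ x, c k (c (i + l + 1) x) = c (i + l + 1) (c k x) := by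
      intro x
      rcases hki with hki | hki
      · exact h.comm _ _ (by omega) (by omega) x
      · exact (h.comm _ _ (by omega) hk x).symm
    rw [ascending, hcomm, ih (by omega) (by omega)]

theorem apply_ascending_pred {k l : ℕ} (hl : k + 1 + l < m) :
    c k (ascending c a (k + 1) l) = ascending c a k (l + 1) := by
  induction l with
  | zero => exact h.move k hl
  | succ l ih =>
    rw [ascending, h.comm _ _ (by omega) (by omega), ih (by omega), ascending]
    congr 1
    omega

theorem apply_ascending_left {i l : ℕ} (hl : i + 1 + l < m) :
    c i (ascending c a i (l + 1)) = ascending c a (i + 1) l := by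
  rw [← apply_ascending_pred h hl, h.invol _ (by omega)]

/-- Commute `c k` inward until it meets `c (k + 1) (c k _)`. The braid relation then moves it to a
`c (k + 1)` acting on a shorter, far element, which it fixes. -/
theorem apply_ascending_of_between {i l k : ℕ} (hl : i + l < m) (h1 : i < k) (h2 : k < i + l) :
    c k (ascending c a i l) = ascending c a i l := by
  induction l with
  | zero => omega
  | succ l ih =>
    rcases Nat.lt_or_ge k (i + l) with hk | hk
    · rw [ascending, h.comm _ _ (by omega) (by omega), ih (by omega) hk]
    · obtain ⟨l, rfl⟩ : ∃ l', l = l' + 1 := ⟨l - 1, by omega⟩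
      obtain rfl : k = i + l + 1 := by omega
      rw [ascending, ascending, show i + (l + 1) + 1 = i + l + 1 + 1 from rfl,
        ← h.braid _ (by omega), apply_ascending_of_far h (by omega) (by omega) (Or.inr (by omega))]

theorem apply_ascending_right {i l : ℕ} (hl : i + l + 1 < m) :
    c (i + l + 1) (ascending c a i (l + 1)) = ascending c a i l := by
  rw [ascending, h.invol _ (by omega)]

omit h in
variable (c a) in
/-- The element attached to the unordered pair `{i, j}`. -/
def pairElement (i j : ℕ) : X :=
  if i < j then ascending c a i (j - i - 1) else ascending c a j (i - j - 1)

omit h in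
theorem pairElement_comm {i j : ℕ} (hij : i ≠ j) : pairElement c a i j = pairElement c a j i := by
  unfold pairElement
  split_ifs <;> first | rfl | omega

omit h in
theorem pairElement_add (i l : ℕ) : pairElement c a i (i + l + 1) = ascending c a i l := by
  rw [pairElement, if_pos (by omega), show i + l + 1 - i - 1 = l by omega]

/-- The operators permute the family as adjacent transpositions permute pairs. The cases are the
positions of `k` and `k + 1` relative to the two ends of the pair. -/
theorem apply_pairElement {i j k : ℕ} (hi : i ≤ m) (hj : j ≤ m) (hij : i ≠ j) (hk : k < m) :
    c k (pairElement c a i j) =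
      pairElement c a (Equiv.swap k (k + 1) i) (Equiv.swap k (k + 1) j) := by
  wlog hlt : i < j generalizing i j
  · rw [pairElement_comm hij, this hj hi hij.symm (by omega),
      pairElement_comm ((Equiv.injective _).ne hij.symm)]
  obtain ⟨l, rfl⟩ : ∃ l, j = i + l + 1 := ⟨j - i - 1, by omega⟩
  rw [pairElement_add]
  by_cases h1 : k = i
  · subst h1
    rw [Equiv.swap_apply_left]
    cases l with
    | zero =>
      rw [Nat.add_zero, Equiv.swap_apply_right, pairElement_comm (by omega)]
      exact (h.fix k hk).trans (pairElement_add k 0).symm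
    | succ l =>
      rw [Equiv.swap_apply_of_ne_of_ne (by omega) (by omega), apply_ascending_left h (by omega),
        show k + (l + 1) + 1 = k + 1 + l + 1 by omega, pairElement_add]
  by_cases h2 : k + 1 = i
  · subst h2
    rw [Equiv.swap_apply_right, Equiv.swap_apply_of_ne_of_ne (by omega) (by omega),
      apply_ascending_pred h (by omega), show k + 1 + l + 1 = k + (l + 1) + 1 by omega,
      pairElement_add]
  rw [Equiv.swap_apply_of_ne_of_ne (Ne.symm h1) (Ne.symm h2)]
  by_cases h3 : k = i + l + 1
  · subst h3
    rw [Equiv.swap_apply_left]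
    exact (pairElement_add i (l + 1)).symm
  by_cases h4 : k = i + l
  · subst h4
    obtain ⟨l, rfl⟩ : ∃ l', l = l' + 1 := ⟨l - 1, by omega⟩
    rw [Equiv.swap_apply_right]
    exact (apply_ascending_right h (by omega)).trans (pairElement_add i l).symm
  rw [Equiv.swap_apply_of_ne_of_ne (by omega) (by omega), pairElement_add]
  by_cases h5 : i < k ∧ k < i + l
  · exact apply_ascending_of_between h (by omega) h5.1 h5.2
  · exact apply_ascending_of_far h (by omega) hk (by omega)

end PairFamily

/-! ### Crossing numbers of braids -/

/-- The unordered pairs of distinct elements of `Fin n`. -/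
abbrev OffDiag (n : ℕ) : Type := {e : Sym2 (Fin n) // ¬e.IsDiag}

namespace OffDiag

variable {n : ℕ}

/-- The pair `{a, b}`. -/
def mk (a b : Fin n) (h : a ≠ b) : OffDiag n := ⟨s(a, b), by simpa using h⟩

instance : MulAction (Equiv.Perm (Fin n)) (OffDiag n) where
  smul w e := ⟨e.1.map w, fun h => e.2 ((Sym2.isDiag_map w.injective).1 h)⟩
  one_smul e := Subtype.ext (by
    change e.1.map (1 : Equiv.Perm (Fin n)) = e.1
    rw [Equiv.Perm.coe_one, Sym2.map_id]; rfl)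
  mul_smul w w' e := Subtype.ext (by
    change e.1.map (w * w') = (e.1.map w').map w
    rw [Sym2.map_map]; rfl)

theorem smul_mk (w : Equiv.Perm (Fin n)) (a b : Fin n) (h : a ≠ b) :
    w • mk a b h = mk (w a) (w b) (w.injective.ne h) := rfl

theorem mk_eq_mk {a b c d : Fin n} {h : a ≠ b} {h' : c ≠ d} :
    mk a b h = mk c d h' ↔ a = c ∧ b = d ∨ a = d ∧ b = c := by
  simp [mk]

theorem mk_comm {a b : Fin n} (h : a ≠ b) : mk a b h = mk b a h.symm := by
  simp [mk_eq_mk]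

theorem exists_eq_mk (e : OffDiag n) : ∃ a b h, e = mk a b h := by
  obtain ⟨e, he⟩ := e
  induction e using Sym2.ind with
  | _ a b => exact ⟨a, b, by simpa using he, rfl⟩

/-- With three distinct points, `a` is the only common element of `{a, b}` and `{a, c}`, so a
permutation preserving both pairs fixes `a`. This fails for `n = 2`. -/
theorem eq_one_of_smul_eq {w : Equiv.Perm (Fin n)} (hn : 3 ≤ n) (hw : ∀ e : OffDiag n, w • e = e) :
    w = 1 := by
  ext1 a
  have : 2 < (Finset.univ : Finset (Fin n)).card := by simpa [Nat.lt_iff_add_one_le] using hn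
  obtain ⟨b, hb⟩ : ∃ b, b ≠ a := by
    obtain ⟨b, -, hb⟩ := Finset.exists_mem_ne (lt_trans one_lt_two this) a
    exact ⟨b, hb⟩
  obtain ⟨c, hc⟩ : ∃ c, c ∉ ({a, b} : Finset (Fin n)) := by
    by_contra! h
    have h2 := Finset.card_le_card (fun c _ => h c : Finset.univ ⊆ ({a, b} : Finset (Fin n)))
    have h3 := Finset.card_le_two (a := a) (b := b)
    omega
  simp only [Finset.mem_insert, Finset.mem_singleton, not_or] at hc
  have h1 := hw (mk a b hb.symm)
  have h2 := hw (mk a c (Ne.symm hc.1))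
  rw [smul_mk, mk_eq_mk] at h1 h2
  rw [Equiv.Perm.one_apply]
  rcases h1 with h1 | h1
  · exact h1.1
  · rcases h2 with h2 | h2
    · exact h2.1
    · exact absurd (h2.1.symm.trans h1.1) hc.2

end OffDiag

/-- The action of the symmetric group on the integral functions on pairs. -/
def permAut (n : ℕ) : Equiv.Perm (Fin n) →* MulAut (OffDiag n → Multiplicative ℤ) :=
  letI : MulDistribMulAction (Equiv.Perm (Fin n)) (OffDiag n → Multiplicative ℤ) :=
    arrowMulDistribMulAction
  MulDistribMulAction.toMulAut _ _

/-- The semidirect product of the integral functions on pairs by the symmetric group. -/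
abbrev PairGroup (n : ℕ) : Type := (OffDiag n → Multiplicative ℤ) ⋊[permAut n] Equiv.Perm (Fin n)

namespace PairGroup

variable {n : ℕ}

/-- The value at a pair of the translation part of an element. -/
def crossing (x : PairGroup n) (e : OffDiag n) : ℤ := (x.left e).toAdd

theorem ext' {x y : PairGroup n} (h : ∀ e, crossing x e = crossing y e) (h' : x.right = y.right) :
    x = y :=
  SemidirectProduct.ext (funext h) h'

theorem crossing_one (e : OffDiag n) : crossing 1 e = 0 := rfl

theorem crossing_mul (x y : PairGroup n) (e : OffDiag n) :
    crossing (x * y) e = crossing x e + crossing y (x.right⁻¹ • e) := rfl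

theorem crossing_inv (x : PairGroup n) (e : OffDiag n) :
    crossing x⁻¹ e = -crossing x (x.right • e) := by
  have := crossing_mul x⁻¹ x e
  rw [inv_mul_cancel, crossing_one, SemidirectProduct.inv_right, inv_inv] at this
  omega

theorem crossing_pow {x : PairGroup n} {e : OffDiag n} (h : x.right • e = e) (k : ℕ) :
    crossing (x ^ k) e = k * crossing x e := by
  induction k with
  | zero => simp [crossing_one]
  | succ k ih =>
    rw [pow_succ', crossing_mul, inv_smul_eq_iff.2 h.symm, ih]
    push_cast
    ring

theorem crossing_conj {x y : PairGroup n} (hy : y.right = 1) (e : OffDiag n) :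
    crossing (x * y * x⁻¹) e = crossing y (x.right⁻¹ • e) := by
  rw [crossing_mul, crossing_mul, crossing_inv, SemidirectProduct.mul_right, hy, mul_one,
    smul_inv_smul]
  ring

/-- The elements whose translation part is odd exactly at the pairs inverted by their image in
the symmetric group. -/
def parity (n : ℕ) : Subgroup (PairGroup n) where
  carrier := {x | ∀ a b h, Even (crossing x (OffDiag.mk a b h)) ↔
    (a < b ↔ x.right⁻¹ a < x.right⁻¹ b)}
  one_mem' a b h := by simp [crossing_one]
  mul_mem' {x y} hx hy a b h := by
    rw [crossing_mul, Int.even_add, hx, OffDiag.smul_mk, hy, SemidirectProduct.mul_right,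
      mul_inv_rev, Equiv.Perm.mul_apply, Equiv.Perm.mul_apply]
    tauto
  inv_mem' {x} hx a b h := by
    rw [crossing_inv, even_neg, OffDiag.smul_mk, hx, SemidirectProduct.inv_right, inv_inv,
      ← Equiv.Perm.mul_apply, ← Equiv.Perm.mul_apply, inv_mul_cancel, Equiv.Perm.one_apply,
      Equiv.Perm.one_apply]
    tauto

/-- The pair `{i, i + 1}`. -/
def adjacentPair (n : ℕ) (i : Fin (n - 1)) : OffDiag n :=
  OffDiag.mk ⟨i, by have := i.isLt; omega⟩ ⟨i + 1, by have := i.isLt; omega⟩ (by simp)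

/-- The image of a braid generator. -/
def generator (n : ℕ) (i : Fin (n - 1)) : PairGroup n :=
  ⟨fun e => Multiplicative.ofAdd (if e = adjacentPair n i then 1 else 0), adjacentSwap n i⟩

theorem crossing_generator (i : Fin (n - 1)) (e : OffDiag n) :
    crossing (generator n i) e = if e = adjacentPair n i then 1 else 0 := rfl

theorem generator_right (i : Fin (n - 1)) : (generator n i).right = adjacentSwap n i := rfl

theorem generator_mem_parity (i : Fin (n - 1)) : generator n i ∈ parity n := by
  intro a b h
  simp only [crossing_generator, generator_right, adjacentSwap, Equiv.swap_inv, adjacentPair,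
    OffDiag.mk_eq_mk, Equiv.swap_apply_def, Fin.ext_iff, ne_eq, Fin.lt_def] at h ⊢
  split_ifs <;> simp only [Int.not_even_one, Even.zero, true_iff, false_iff] <;> omega

theorem adjacentSwap_smul_of_far {i j : Fin (n - 1)} (h : (i : ℕ) + 2 ≤ j ∨ (j : ℕ) + 2 ≤ i) :
    adjacentSwap n i • adjacentPair n j = adjacentPair n j := by
  rw [adjacentSwap, adjacentPair, OffDiag.smul_mk, OffDiag.mk_eq_mk]
  simp only [Equiv.swap_apply_def, Fin.ext_iff]
  split_ifs <;> simp <;> omega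

theorem adjacentSwap_smul_of_succ {i j : Fin (n - 1)} (h : (j : ℕ) = i + 1) :
    adjacentSwap n j • adjacentPair n i = adjacentSwap n i • adjacentPair n j := by
  rw [adjacentSwap, adjacentSwap, adjacentPair, adjacentPair, OffDiag.smul_mk, OffDiag.smul_mk,
    OffDiag.mk_eq_mk]
  simp only [Equiv.swap_apply_def, Fin.ext_iff]
  split_ifs <;> simp <;> omega

theorem adjacentSwap_mul_self (i : Fin (n - 1)) : adjacentSwap n i * adjacentSwap n i = 1 :=
  Equiv.swap_mul_self _ _

theorem generator_relators (n : ℕ) :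
    ∀ r ∈ braidRelators n, FreeGroup.lift (generator n) r = 1 := by
  intro r hr
  have hright := adjacentSwap_relators n r hr
  rcases hr with ⟨i, j, hij, rfl⟩ | ⟨i, j, hij, rfl⟩
  · simp only [map_mul, map_inv, FreeGroup.lift_apply_of, mul_inv_eq_one] at hright ⊢
    refine ext' (fun e => ?_) hright
    simp only [crossing_mul, crossing_generator, generator_right, inv_smul_eq_iff,
      adjacentSwap_smul_of_far (Or.inl hij), adjacentSwap_smul_of_far (Or.inr hij)]
    ring
  · simp only [map_mul, map_inv, FreeGroup.lift_apply_of, mul_inv_eq_one] at hright ⊢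
    refine ext' (fun e => ?_) hright
    -- Either side of the braid relation crosses each of the three pairs among `i, i + 1, i + 2`
    -- exactly once.
    have h1 := adjacentSwap_smul_of_succ hij
    have h2 : (adjacentSwap n j * adjacentSwap n i) • adjacentPair n j = adjacentPair n i := by
      rw [mul_smul, ← h1, ← mul_smul, adjacentSwap_mul_self, one_smul]
    have h3 : (adjacentSwap n i * adjacentSwap n j) • adjacentPair n i = adjacentPair n j := by
      rw [mul_smul, h1, ← mul_smul, adjacentSwap_mul_self, one_smul]
    simp only [crossing_mul, crossing_generator, generator_right, SemidirectProduct.mul_right,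
      inv_smul_eq_iff, h1, h2, h3]
    ring

end PairGroup

open PairGroup

/-- The homomorphism from the braid group to the semidirect product of the integral functions on
pairs by the symmetric group. -/
def braidPair (n : ℕ) : BraidGroup n →* PairGroup n :=
  PresentedGroup.toGroup (generator_relators n)

theorem braidPair_of {n : ℕ} (i : Fin (n - 1)) :
    braidPair n (PresentedGroup.of i) = generator n i :=
  PresentedGroup.toGroup.of _

theorem braidPair_right {n : ℕ} (x : BraidGroup n) : (braidPair n x).right = braidPerm n x := by
  have : SemidirectProduct.rightHom.comp (braidPair n) = braidPerm n := by
    refine PresentedGroup.ext fun i => ?_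
    rw [MonoidHom.comp_apply, braidPair_of, braidPerm, PresentedGroup.toGroup.of]
    rfl
  exact DFunLike.congr_fun this x

namespace BraidQuotient

variable (n : ℕ)

/-- The homomorphism induced by `braidPair` on `B_n / [P_n, P_n]`. -/
def toPair : BraidQuotient n →* PairGroup n :=
  QuotientGroup.lift _ (braidPair n) <| by
    rw [Subgroup.commutator_le]
    intro x hx y hy
    have hx' : (braidPair n x).right = 1 := (braidPair_right x).trans hx
    have hy' : (braidPair n y).right = 1 := (braidPair_right y).trans hy
    rw [MonoidHom.mem_ker, map_commutatorElement, commutatorElement_eq_one_iff_mul_comm]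
    refine ext' (fun e => ?_) ?_
    · rw [crossing_mul, crossing_mul, hx', hy', inv_one, one_smul]
      ring
    · rw [SemidirectProduct.mul_right, SemidirectProduct.mul_right, hx', hy']

/-- The projection of `B_n / [P_n, P_n]` onto the symmetric group. -/
def perm : BraidQuotient n →* Equiv.Perm (Fin n) := SemidirectProduct.rightHom.comp (toPair n)

variable {n}

theorem toPair_right (x : BraidQuotient n) : (toPair n x).right = perm n x := rfl

theorem perm_mk (x : BraidGroup n) : perm n (QuotientGroup.mk x) = braidPerm n x :=
  braidPair_right x

variable (n) in
/-- The generators of `B_n / [P_n, P_n]`. -/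
def gen (k : ℕ) : BraidQuotient n :=
  if h : k < n - 1 then QuotientGroup.mk (PresentedGroup.of ⟨k, h⟩) else 1

theorem gen_eq {k : ℕ} (h : k < n - 1) :
    gen n k = QuotientGroup.mk (PresentedGroup.of ⟨k, h⟩) := dif_pos h

theorem toPair_gen {k : ℕ} (h : k < n - 1) : toPair n (gen n k) = generator n ⟨k, h⟩ := by
  rw [gen_eq h]
  exact braidPair_of _

theorem perm_gen {k : ℕ} (h : k < n - 1) : perm n (gen n k) = adjacentSwap n ⟨k, h⟩ := by
  rw [← toPair_right, toPair_gen h, generator_right]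

theorem closure_gen : Subgroup.closure (gen n '' Set.Iio (n - 1)) = ⊤ := by
  have h := congrArg (Subgroup.map (QuotientGroup.mk' ⁅pureBraidGroup n, pureBraidGroup n⁆))
    (PresentedGroup.closure_range_of (braidRelators n))
  rw [MonoidHom.map_closure, Subgroup.map_top_of_surjective _ (QuotientGroup.mk'_surjective _)] at h
  rw [eq_top_iff, ← h, Subgroup.closure_le]
  rintro _ ⟨_, ⟨i, rfl⟩, rfl⟩
  exact Subgroup.subset_closure ⟨i, i.2, gen_eq i.2⟩

theorem gen_braid {k : ℕ} (h : k + 1 < n - 1) :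
    gen n (k + 1) * gen n k * gen n (k + 1) = gen n k * gen n (k + 1) * gen n k := by
  rw [gen_eq h, gen_eq (show k < n - 1 by omega)]
  have := PresentedGroup.one_of_mem (rels := braidRelators n)
    (Or.inr ⟨⟨k, by omega⟩, ⟨k + 1, h⟩, rfl, rfl⟩)
  rw [map_mul, map_inv, mul_inv_eq_one] at this
  exact congrArg (QuotientGroup.mk' ⁅pureBraidGroup n, pureBraidGroup n⁆) this

theorem gen_comm {i j : ℕ} (hij : i + 2 ≤ j) (hj : j < n - 1) :
    gen n i * gen n j = gen n j * gen n i := by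
  rw [gen_eq hj, gen_eq (show i < n - 1 by omega)]
  have := PresentedGroup.one_of_mem (rels := braidRelators n)
    (Or.inl ⟨⟨i, by omega⟩, ⟨j, hj⟩, hij, rfl⟩)
  rw [map_mul, map_inv, mul_inv_eq_one] at this
  exact congrArg (QuotientGroup.mk' ⁅pureBraidGroup n, pureBraidGroup n⁆) this

theorem toPair_mem_parity (x : BraidQuotient n) : toPair n x ∈ parity n := by
  have h : (⊤ : Subgroup (BraidQuotient n)) ≤ (parity n).comap (toPair n) := by
    rw [← closure_gen, Subgroup.closure_le]
    rintro _ ⟨k, hk, rfl⟩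
    change toPair n (gen n k) ∈ parity n
    rw [toPair_gen hk]
    exact generator_mem_parity _
  exact h (Subgroup.mem_top x)

theorem perm_surjective : Function.Surjective (perm n) := by
  cases n with
  | zero => exact fun w => ⟨1, Subsingleton.elim _ _⟩
  | succ n =>
    rw [← MonoidHom.range_eq_top, eq_top_iff]
    intro w _
    have hw : w ∈ Submonoid.closure (Set.range fun i : Fin n => Equiv.swap i.castSucc i.succ) := by
      rw [Equiv.Perm.mclosure_swap_castSucc_succ]
      trivial
    refine (Submonoid.closure_le (S := (perm (n + 1)).range.toSubmonoid)).2 ?_ hw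
    rintro _ ⟨i, rfl⟩
    exact ⟨gen (n + 1) i, perm_gen i.2⟩

end BraidQuotient

/-! ### The abelianized pure braid group -/

namespace BraidQuotient

variable (n : ℕ)

/-- The image `P_n / [P_n, P_n]` of the pure braid group. -/
def pure : Subgroup (BraidQuotient n) := (perm n).ker

instance : (pure n).Normal := inferInstanceAs (perm n).ker.Normal

variable {n}

theorem pure_commute {x y : BraidQuotient n} (hx : x ∈ pure n) (hy : y ∈ pure n) :
    x * y = y * x := by
  obtain ⟨x, rfl⟩ := QuotientGroup.mk_surjective x
  obtain ⟨y, rfl⟩ := QuotientGroup.mk_surjective y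
  have hx' : x ∈ pureBraidGroup n := (perm_mk x).symm.trans hx
  have hy' : y ∈ pureBraidGroup n := (perm_mk y).symm.trans hy
  rw [← commutatorElement_eq_one_iff_mul_comm]
  exact (QuotientGroup.eq_one_iff _).2 (Subgroup.commutator_mem_commutator hx' hy')

instance : CommGroup (pure n) where
  mul_comm x y := Subtype.ext (pure_commute x.2 y.2)

/-- The translation part, as a homomorphism on the pure part. -/
def pureLeft : pure n →* (OffDiag n → Multiplicative ℤ) where
  toFun x := (toPair n x).left
  map_one' := rfl
  map_mul' x y := by
    have hx : (toPair n x).right = 1 := x.2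
    rw [Subgroup.coe_mul, map_mul, SemidirectProduct.mul_left, hx, map_one]
    rfl

variable (n) in
/-- The action by conjugation of a generator on the pure part. -/
def conjGen (k : ℕ) (x : pure n) : pure n := MulAut.conjNormal (gen n k) x

theorem coe_conjGen (k : ℕ) (x : pure n) :
    (conjGen n k x : BraidQuotient n) = gen n k * x * (gen n k)⁻¹ := rfl

theorem gen_sq_mem {k : ℕ} (hk : k < n - 1) : gen n k * gen n k ∈ pure n := by
  change perm n (gen n k * gen n k) = 1
  rw [map_mul, perm_gen hk, adjacentSwap_mul_self]

variable (n) in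
/-- The square of a generator. -/
def genSq (k : ℕ) : pure n :=
  if h : k < n - 1 then ⟨gen n k * gen n k, gen_sq_mem h⟩ else 1

theorem coe_genSq {k : ℕ} (h : k < n - 1) : (genSq n k : BraidQuotient n) = gen n k * gen n k := by
  rw [genSq, dif_pos h]

/-- The square of a generator is pure, so it commutes with pure elements modulo commutators. -/
theorem conjGen_conjGen {k : ℕ} (hk : k < n - 1) (x : pure n) :
    conjGen n k (conjGen n k x) = x := by
  refine Subtype.ext ?_
  have := pure_commute (gen_sq_mem hk) x.2
  rw [coe_conjGen, coe_conjGen]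
  calc _ = gen n k * gen n k * x * (gen n k * gen n k)⁻¹ := by group
    _ = x := by rw [this, mul_inv_cancel_right]

theorem conjGen_mul (j k : ℕ) (x : pure n) :
    conjGen n j (conjGen n k x) = MulAut.conjNormal (gen n j * gen n k) x := by
  rw [map_mul]
  rfl

theorem conjGen_of_far {i j : ℕ} (h : gen n i * gen n j = gen n j * gen n i) (hj : j < n - 1) :
    conjGen n i (genSq n j) = genSq n j := by
  refine Subtype.ext ?_
  rw [coe_conjGen, coe_genSq hj, ← mul_assoc, h, mul_assoc (gen n j), h]
  group

theorem conjGen_relations : PairFamily.Relations (conjGen n) (genSq n) (n - 1) where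
  invol k hk x := conjGen_conjGen hk x
  braid k hk x := by
    have h : ∀ i j k : ℕ, conjGen n i (conjGen n j (conjGen n k x)) =
        MulAut.conjNormal (gen n i * gen n j * gen n k) x := fun i j k => by
      rw [conjGen_mul j, map_mul, mul_assoc (gen n i), map_mul, map_mul]
      rfl
    rw [h, h, gen_braid hk]
  comm i j hij hj x := by rw [conjGen_mul, conjGen_mul, gen_comm hij hj]
  fix k hk := conjGen_of_far rfl hk
  fix_left i j hij hj := conjGen_of_far (gen_comm hij hj) hj
  fix_right i j hij hj := conjGen_of_far (gen_comm hij hj).symm (by omega)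
  move k hk := by
    have hk' : k < n - 1 := by omega
    -- By the braid relation, `σ_{k+1} σ_k` conjugates `σ_{k+1}` to `σ_k`, hence the square of the
    -- one to the square of the other.
    have h : conjGen n (k + 1) (conjGen n k (genSq n (k + 1))) = genSq n k := by
      refine Subtype.ext ?_
      rw [coe_conjGen, coe_conjGen, coe_genSq hk, coe_genSq hk']
      have h1 : gen n (k + 1) * gen n k * gen n (k + 1) * (gen n (k + 1) * gen n k)⁻¹ = gen n k := by
        rw [gen_braid hk]
        group
      calc _ = (gen n (k + 1) * gen n k * gen n (k + 1) * (gen n (k + 1) * gen n k)⁻¹) *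
            (gen n (k + 1) * gen n k * gen n (k + 1) * (gen n (k + 1) * gen n k)⁻¹) := by group
        _ = _ := by rw [h1]
    rw [← h, conjGen_conjGen hk]

variable (n) in
/-- The pure braid generator, modulo commutators, attached to a pair. -/
def pairGen (e : OffDiag n) : pure n :=
  e.1.lift ⟨fun i j : Fin n => PairFamily.pairElement (conjGen n) (genSq n) i j, fun i j => by
    by_cases h : (i : ℕ) = j
    · rw [Fin.ext h]
    · exact PairFamily.pairElement_comm h⟩

theorem pairGen_mk {i j : Fin n} (h : i ≠ j) :
    pairGen n (OffDiag.mk i j h) = PairFamily.pairElement (conjGen n) (genSq n) i j := rfl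

theorem coe_adjacentSwap {k : ℕ} (hk : k < n - 1) (i : Fin n) :
    (adjacentSwap n ⟨k, hk⟩ i : ℕ) = Equiv.swap k (k + 1) (i : ℕ) := by
  simp only [adjacentSwap, Equiv.swap_apply_def, Fin.ext_iff]
  split_ifs <;> rfl

theorem conjGen_pairGen {k : ℕ} (hk : k < n - 1) (e : OffDiag n) :
    conjGen n k (pairGen n e) = pairGen n (adjacentSwap n ⟨k, hk⟩ • e) := by
  obtain ⟨i, j, h, rfl⟩ := e.exists_eq_mk
  have hi := i.isLt
  have hj := j.isLt
  rw [OffDiag.smul_mk, pairGen_mk, pairGen_mk, PairFamily.apply_pairElement conjGen_relations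
    (by omega) (by omega) (by rwa [ne_eq, ← Fin.ext_iff]) hk, coe_adjacentSwap, coe_adjacentSwap]

/-- A square `σ_i²` crosses its pair twice, since `(i, i+1)` preserves that pair; each conjugation
then moves the upper end of the pair one step. -/
theorem crossing_ascending (i l : ℕ) (h : i + l < n - 1) (e : OffDiag n) :
    crossing (toPair n (PairFamily.ascending (conjGen n) (genSq n) i l : pure n)) e =
      if e = OffDiag.mk ⟨i, by omega⟩ ⟨i + l + 1, by omega⟩ (by simp; omega) then 2 else 0 := by
  induction l generalizing e with
  | zero =>
    have hi : i < n - 1 := by omega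
    have h1 : (adjacentSwap n ⟨i, hi⟩)⁻¹ • e = adjacentPair n ⟨i, hi⟩ ↔
        e = adjacentPair n ⟨i, hi⟩ := by
      rw [inv_smul_eq_iff]
      simp only [adjacentPair, adjacentSwap, OffDiag.smul_mk, Equiv.swap_apply_left,
        Equiv.swap_apply_right]
      rw [OffDiag.mk_comm]
    rw [PairFamily.ascending, coe_genSq hi, map_mul, toPair_gen hi, crossing_mul,
      crossing_generator, crossing_generator, generator_right]
    simp only [h1]
    change _ = if e = adjacentPair n ⟨i, hi⟩ then 2 else 0
    split_ifs <;> rfl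
  | succ l ih =>
    have hk : i + l + 1 < n - 1 := by omega
    have hpure : (toPair n (PairFamily.ascending (conjGen n) (genSq n) i l : pure n)).right = 1 :=
      (PairFamily.ascending (conjGen n) (genSq n) i l).2
    rw [PairFamily.ascending, coe_conjGen, map_mul, map_mul, map_inv, crossing_conj hpure,
      ih (by omega), toPair_right, perm_gen hk]
    simp only [inv_smul_eq_iff, OffDiag.smul_mk]
    have h1 : adjacentSwap n ⟨i + l + 1, hk⟩ ⟨i, by omega⟩ = ⟨i, by omega⟩ := by
      rw [Fin.ext_iff, coe_adjacentSwap, Equiv.swap_apply_of_ne_of_ne] <;> simp <;> omega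
    have h2 : adjacentSwap n ⟨i + l + 1, hk⟩ ⟨i + l + 1, by omega⟩ =
        ⟨i + (l + 1) + 1, by omega⟩ := by
      rw [Fin.ext_iff, coe_adjacentSwap, Equiv.swap_apply_left]
      rfl
    simp only [h1, h2]

theorem crossing_pairGen (e e' : OffDiag n) :
    crossing (toPair n (pairGen n e)) e' = if e' = e then 2 else 0 := by
  obtain ⟨i, j, h, rfl⟩ := e.exists_eq_mk
  wlog hij : i < j generalizing i j
  · rw [OffDiag.mk_comm]
    exact this j i h.symm (lt_of_le_of_ne (not_lt.1 hij) h.symm)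
  obtain ⟨i, hi⟩ := i
  obtain ⟨j, hj⟩ := j
  rw [Fin.mk_lt_mk] at hij
  obtain ⟨l, rfl⟩ : ∃ l, j = i + l + 1 := ⟨j - i - 1, by omega⟩
  rw [pairGen_mk, PairFamily.pairElement_add, crossing_ascending i l (by omega)]

variable (n) in
/-- The homomorphism from the integral functions on pairs to the pure part of
`B_n / [P_n, P_n]`. -/
def translation : Multiplicative (OffDiag n → ℤ) →* pure n where
  toFun v := ∏ e, pairGen n e ^ (v.toAdd e)
  map_one' := by simp
  map_mul' v w := by simp [zpow_add, Finset.prod_mul_distrib]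

theorem crossing_translation (v : OffDiag n → ℤ) (e : OffDiag n) :
    crossing (toPair n (translation n (Multiplicative.ofAdd v))) e = 2 * v e := by
  have h : ∀ x : pure n, crossing (toPair n x) e = (pureLeft x e).toAdd := fun _ => rfl
  have h2 : ∀ e', (pureLeft (pairGen n e') e).toAdd = if e = e' then 2 else 0 :=
    fun e' => crossing_pairGen e' e
  rw [h, translation]
  simp [Finset.prod_apply, h2, mul_comm]

theorem pairGen_mem_range (e : OffDiag n) : pairGen n e ∈ (translation n).range := by
  refine ⟨Multiplicative.ofAdd (Pi.single e 1), ?_⟩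
  change ∏ e', pairGen n e' ^ ((Pi.single e 1 : OffDiag n → ℤ) e') = _
  rw [Finset.prod_eq_single e]
  · simp
  · intro e' _ h
    simp [h]
  · simp

variable (n) in
/-- The subgroup generated by the pure braid generators. -/
def pairSubgroup : Subgroup (BraidQuotient n) :=
  (Subgroup.closure (Set.range (pairGen n))).map (pure n).subtype

theorem pairSubgroup_le : pairSubgroup n ≤ pure n := by
  rintro _ ⟨x, -, rfl⟩
  exact x.2

theorem conjGen_mem {k : ℕ} (hk : k < n - 1) {x : pure n}
    (hx : x ∈ Subgroup.closure (Set.range (pairGen n))) :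
    conjGen n k x ∈ Subgroup.closure (Set.range (pairGen n)) := by
  have : Subgroup.closure (Set.range (pairGen n)) ≤
      (Subgroup.closure (Set.range (pairGen n))).comap
        (MulAut.conjNormal (gen n k)).toMonoidHom := by
    rw [Subgroup.closure_le]
    rintro _ ⟨e, rfl⟩
    refine Subgroup.subset_closure ⟨adjacentSwap n ⟨k, hk⟩ • e, ?_⟩
    exact (conjGen_pairGen hk e).symm
  exact this hx

instance : (pairSubgroup n).Normal := by
  rw [← Subgroup.normalizer_eq_top_iff, eq_top_iff, ← closure_gen, Subgroup.closure_le]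
  rintro _ ⟨k, hk, rfl⟩
  refine Subgroup.mem_normalizer_iff.2 fun x => ⟨?_, fun hx => ?_⟩
  · rintro ⟨x, hx, rfl⟩
    exact ⟨conjGen n k x, conjGen_mem hk hx, rfl⟩
  · have hx' : x ∈ pure n := by
      have := (inferInstance : (pure n).Normal).conj_mem _ (pairSubgroup_le hx) (gen n k)⁻¹
      simpa [mul_assoc] using this
    obtain ⟨y, hy, hyx⟩ := hx
    refine ⟨conjGen n k y, conjGen_mem hk hy, ?_⟩
    have : y = conjGen n k ⟨x, hx'⟩ := Subtype.ext hyx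
    rw [this, conjGen_conjGen hk]
    rfl

/-- The pure part of `B_n / [P_n, P_n]` is generated by the pure braid generators. -/
theorem pure_le_pairSubgroup [NeZero n] : pure n ≤ pairSubgroup n := by
  intro x hx
  -- Modulo `pairSubgroup n` the squares of the generators vanish, so the Coxeter relations hold and
  -- the quotient embeds in the symmetric group. An element with trivial permutation is therefore
  -- trivial there.
  let s : ℕ → BraidQuotient n ⧸ pairSubgroup n := fun k => QuotientGroup.mk (gen n k)
  have hs : CoxeterA.Relations s (n - 1) := by
    refine ⟨fun i hi => ?_, fun i hi => ?_, fun i j hij hj => ?_⟩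
    · refine (QuotientGroup.eq_one_iff (gen n i * gen n i)).2
        ⟨genSq n i, Subgroup.subset_closure ⟨adjacentPair n ⟨i, hi⟩, ?_⟩, coe_genSq hi⟩
      exact PairFamily.pairElement_add i 0
    · exact congrArg (QuotientGroup.mk' (pairSubgroup n)) (gen_braid hi)
    · exact congrArg (QuotientGroup.mk' (pairSubgroup n)) (gen_comm hij hj)
  let f : BraidQuotient n ⧸ pairSubgroup n →* Equiv.Perm (Fin n) :=
    QuotientGroup.lift _ (perm n) pairSubgroup_le
  have hn := Nat.pos_of_neZero n
  have hp : ∀ i, i ≤ n - 1 → (Fin.ofNat n i : ℕ) = i := fun i hi =>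
    Nat.mod_eq_of_lt (by omega)
  refine (QuotientGroup.eq_one_iff x).1 (CoxeterA.eq_one_of_map_eq_one hs (p := Fin.ofNat n)
    (fun i hi j hj hij => ?_) f (fun i hi => ?_) le_rfl (x := QuotientGroup.mk x) ?_ hx)
  · rw [← hp i hi, ← hp j hj, hij]
  · refine (perm_gen hi).trans ?_
    rw [adjacentSwap]
    congr 1
    · exact Fin.ext (hp i (by omega)).symm
    · exact Fin.ext (hp (i + 1) (by omega)).symm
  · have h := congrArg (Subgroup.map (QuotientGroup.mk' (pairSubgroup n))) (closure_gen (n := n))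
    rw [MonoidHom.map_closure, Subgroup.map_top_of_surjective _ (QuotientGroup.mk'_surjective _),
      ← Set.image_comp] at h
    exact h.symm ▸ Subgroup.mem_top _

theorem exists_eq_translation [NeZero n] {x : BraidQuotient n} (hx : perm n x = 1) :
    ∃ v : OffDiag n → ℤ, x = translation n (Multiplicative.ofAdd v) := by
  obtain ⟨y, hy, rfl⟩ := pure_le_pairSubgroup (show x ∈ pure n from hx)
  have : Subgroup.closure (Set.range (pairGen n)) ≤ (translation n).range := by
    rw [Subgroup.closure_le]
    rintro _ ⟨e, rfl⟩
    exact pairGen_mem_range e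
  obtain ⟨v, rfl⟩ := this hy
  exact ⟨v.toAdd, rfl⟩

theorem perm_translation (v : Multiplicative (OffDiag n → ℤ)) : perm n (translation n v) = 1 :=
  (translation n v).2

end BraidQuotient

/-! ### Flat actions are Bieberbach groups -/

namespace FlatAction

variable {Γ : Type} [Group Γ] {d : ℕ} [FlatAction Γ d]

/-- The translation part and the linear part of an isometry. -/
def isometryParts (d : ℕ) (a : EuclideanIsometry d) :
    EuclideanSpace ℝ (Fin d) × (EuclideanSpace ℝ (Fin d) →L[ℝ] EuclideanSpace ℝ (Fin d)) :=
  (a 0, a.linearIsometryEquiv.toContinuousLinearEquiv)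

theorem isInducing_isometryParts : Topology.IsInducing (isometryParts d) := ⟨rfl⟩

theorem apply_eq_isometryParts (a : EuclideanIsometry d) (x : EuclideanSpace ℝ (Fin d)) :
    a x = (isometryParts d a).2 x + (isometryParts d a).1 := by
  have := a.map_vadd 0 x
  simp only [vadd_eq_add, add_zero] at this
  exact this

theorem isometryParts_injective : Function.Injective (isometryParts d) := fun a b h =>
  AffineIsometryEquiv.ext fun x => by rw [apply_eq_isometryParts, h, ← apply_eq_isometryParts]

/-- The image is a closed ball times the norm-preserving operators, a closed bounded set in finite
dimension. This is the compactness of `O(d)` behind uniformity. -/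
theorem isCompact_isometryParts_image (C : ℝ) :
    IsCompact (isometryParts d '' {a | ‖a 0‖ ≤ C}) := by
  have : isometryParts d '' {a | ‖a 0‖ ≤ C} =
      Metric.closedBall 0 C ×ˢ {A | ∀ x, ‖A x‖ = ‖x‖} := by
    ext ⟨v, A⟩
    constructor
    · rintro ⟨a, ha, h⟩
      rw [← h]
      exact ⟨by rw [mem_closedBall_zero_iff]; exact ha, a.linearIsometryEquiv.norm_map⟩
    · rintro ⟨hv, hA⟩
      let L : EuclideanSpace ℝ (Fin d) →ₗᵢ[ℝ] EuclideanSpace ℝ (Fin d) := ⟨A, hA⟩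
      let a : EuclideanIsometry d := (L.toLinearIsometryEquiv rfl).toAffineIsometryEquiv.trans
        (AffineIsometryEquiv.constVAdd ℝ _ v)
      have h0 : a 0 = v := by simp [a]
      refine ⟨a, ?_, Prod.ext h0 (ContinuousLinearMap.ext fun x => ?_)⟩
      · simpa [h0] using hv
      · have := apply_eq_isometryParts a x
        change a x = _ + a 0 at this
        rw [h0] at this
        refine add_right_cancel (this.symm.trans ?_)
        simp [a, L, add_comm]
  rw [this]
  refine (isCompact_closedBall _ _).prod ?_
  have : ProperSpace (EuclideanSpace ℝ (Fin d) →L[ℝ] EuclideanSpace ℝ (Fin d)) :=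
    FiniteDimensional.proper ℝ _
  refine Metric.isCompact_of_isClosed_isBounded ?_ ?_
  · rw [Set.ofPred_forall]
    exact isClosed_iInter fun x => isClosed_eq (by fun_prop) continuous_const
  · refine (Metric.isBounded_closedBall (x := 0) (r := 1)).subset fun A hA => ?_
    rw [mem_closedBall_zero_iff]
    exact A.opNorm_le_bound zero_le_one fun x => by rw [hA x, one_mul]

theorem toIsometry_injective :
    Function.Injective (toIsometry : Γ →* EuclideanIsometry d) := fun g h hgh =>
  eq_of_dist_lt (d := d) (x := 0) (by rw [smul_def, smul_def, hgh, dist_self]; exact one_pos)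

theorem one_le_dist_isometryParts {g h : Γ} (hgh : g ≠ h) :
    1 ≤ dist (isometryParts d (toIsometry g)) (isometryParts d (toIsometry h)) := by
  by_contra! hlt
  exact hgh (eq_of_dist_lt (d := d) (x := 0) (lt_of_le_of_lt (le_max_left _ _) hlt))

variable (Γ d) in
theorem isCrystallographicSubgroup_range :
    IsCrystallographicSubgroup (toIsometry : Γ →* EuclideanIsometry d).range where
  discrete := by
    rw [discreteTopology_iff_isOpen_singleton]
    rintro ⟨_, g, rfl⟩
    have hc : Continuous fun a : (toIsometry : Γ →* EuclideanIsometry d).range =>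
        isometryParts d a := isInducing_isometryParts.continuous.comp continuous_subtype_val
    convert (Metric.isOpen_ball (x := isometryParts d (toIsometry g)) (ε := 1)).preimage hc
    ext ⟨_, h, rfl⟩
    simp only [Set.mem_singleton_iff, Set.mem_preimage, Metric.mem_ball]
    refine ⟨fun e => ?_, fun hlt => ?_⟩
    · have e' : toIsometry h = toIsometry g := congrArg Subtype.val e
      rw [e', dist_self]
      exact one_pos
    by_contra hne
    exact hlt.not_ge (one_le_dist_isometryParts fun e => hne (by rw [e]))
  closed := by
    have : ((toIsometry : Γ →* EuclideanIsometry d).range : Set (EuclideanIsometry d)) =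
        isometryParts d ⁻¹' (Set.range fun g : Γ => isometryParts d (toIsometry g)) := by
      ext a
      exact ⟨fun ⟨g, hg⟩ => ⟨g, congrArg _ hg⟩, fun ⟨g, hg⟩ => ⟨g, isometryParts_injective hg⟩⟩
    rw [this]
    refine IsClosed.preimage isInducing_isometryParts.continuous
      (Metric.isClosed_of_pairwise_le_dist one_pos ?_)
    rintro _ ⟨g, rfl⟩ _ ⟨h, rfl⟩ hne
    exact one_le_dist_isometryParts fun e => hne (by rw [e])
  uniform := by
    obtain ⟨C, hC⟩ := exists_norm_le (Γ := Γ) (d := d)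
    refine ⟨?_⟩
    have hK : IsCompact {a : EuclideanIsometry d | ‖a 0‖ ≤ C} :=
      isInducing_isometryParts.isCompact_iff.2 (isCompact_isometryParts_image C)
    have hc : Continuous (QuotientGroup.mk :
        EuclideanIsometry d → _ ⧸ (toIsometry : Γ →* EuclideanIsometry d).range) :=
      continuous_quotient_mk'
    refine (hK.image hc).of_isClosed_subset isClosed_univ fun q _ => ?_
    obtain ⟨a, rfl⟩ := QuotientGroup.mk_surjective q
    -- Cosets have the form `a H`. The representative `a g⁻¹` moves the origin as far as its inverse
    -- `g a⁻¹` does, so the orbit bound is needed at `a⁻¹ 0`.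
    obtain ⟨g, hg⟩ := hC (a⁻¹ 0)
    refine ⟨a * (toIsometry g)⁻¹, ?_, ?_⟩
    · have h1 : ∀ b : EuclideanIsometry d, dist (b 0) 0 = dist (b⁻¹ 0) 0 := fun b => by
        rw [← b⁻¹.dist_map, dist_comm]
        congr 1
        exact b.symm_apply_apply 0
      rw [← dist_zero_right] at hg
      rw [Set.mem_ofPred_eq, ← dist_zero_right, h1, mul_inv_rev, inv_inv]
      exact hg
    · refine QuotientGroup.eq.2 ⟨g, ?_⟩
      group

end FlatAction

/-! ### Bieberbach subgroups of `B_n / [P_n, P_n]` -/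

/-- A faithful permutation representation of `G` on `Fin n`, with characters of `G` which separate
its elements, each of them carried by a pair of fixed points. -/
structure MarkedRep (G : Type*) [Group G] (n : ℕ) where
  Index : Type
  rep : G →* Equiv.Perm (Fin n)
  rep_injective : Function.Injective rep
  modulus : Index → ℕ
  modulus_pos : ∀ i, 0 < modulus i
  char : ∀ i, G →* Multiplicative (ZMod (modulus i))
  eq_one : ∀ g, (∀ i, char i g = 1) → g = 1
  pair : Index → OffDiag n
  pair_injective : Function.Injective pair
  fixed : ∀ i, ∃ a b h, pair i = OffDiag.mk a b h ∧ ∀ g, rep g a = a ∧ rep g b = b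

namespace MarkedRep

variable {G : Type*} [Group G] {n : ℕ} (R : MarkedRep G n)

theorem rep_smul_pair (g : G) (i : R.Index) : R.rep g • R.pair i = R.pair i := by
  obtain ⟨a, b, h, hab, hfix⟩ := R.fixed i
  rw [hab, OffDiag.smul_mk, OffDiag.mk_eq_mk]
  exact Or.inl (hfix g)

theorem rep_inv_smul_pair (g : G) (i : R.Index) : (R.rep g)⁻¹ • R.pair i = R.pair i := by
  rw [inv_smul_eq_iff, rep_smul_pair]

/-- The subgroup of the elements lying above `G`, whose crossing numbers at the marked pairs are
prescribed by the characters. -/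
def subgroup : Subgroup (BraidQuotient n) where
  carrier := {q | ∃ g, BraidQuotient.perm n q = R.rep g ∧ ∀ i, ∃ k : ℤ,
    crossing (BraidQuotient.toPair n q) (R.pair i) = 2 * k ∧
      Multiplicative.ofAdd (k : ZMod (R.modulus i)) = R.char i g}
  one_mem' := ⟨1, by rw [map_one, map_one], fun i => ⟨0, by rw [map_one]; rfl, by simp⟩⟩
  mul_mem' := by
    rintro x y ⟨g, hg, hx⟩ ⟨h, hh, hy⟩
    refine ⟨g * h, by rw [map_mul, map_mul, hg, hh], fun i => ?_⟩
    obtain ⟨k, hk, hkg⟩ := hx i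
    obtain ⟨l, hl, hlh⟩ := hy i
    refine ⟨k + l, ?_, ?_⟩
    · rw [map_mul, crossing_mul, BraidQuotient.toPair_right, hg, rep_inv_smul_pair, hk, hl]
      ring
    · rw [Int.cast_add, ofAdd_add, hkg, hlh, map_mul]
  inv_mem' := by
    rintro x ⟨g, hg, hx⟩
    refine ⟨g⁻¹, by rw [map_inv, map_inv, hg], fun i => ?_⟩
    obtain ⟨k, hk, hkg⟩ := hx i
    refine ⟨-k, ?_, ?_⟩
    · rw [map_inv, crossing_inv, BraidQuotient.toPair_right, hg, rep_smul_pair, hk]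
      ring
    · rw [Int.cast_neg, ofAdd_neg, hkg, map_inv]

/-- The projection of the subgroup onto `G`. -/
def toGroup : R.subgroup →* G :=
  (MonoidHom.ofInjective R.rep_injective).symm.toMonoidHom.comp
    (((BraidQuotient.perm n).comp R.subgroup.subtype).codRestrict R.rep.range
      fun q => let ⟨g, hg, _⟩ := q.2; ⟨g, hg.symm⟩)

variable {R}

theorem rep_toGroup (q : R.subgroup) : R.rep (R.toGroup q) = BraidQuotient.perm n q := by
  change (MonoidHom.ofInjective R.rep_injective (R.toGroup q) : Equiv.Perm (Fin n)) = _
  rw [toGroup, MonoidHom.comp_apply]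
  exact congrArg Subtype.val (MulEquiv.apply_symm_apply _ _)

theorem toGroup_eq_one_iff (q : R.subgroup) :
    R.toGroup q = 1 ↔ BraidQuotient.perm n q = 1 := by
  rw [← rep_toGroup, map_eq_one_iff _ R.rep_injective]

theorem exists_crossing_eq (q : R.subgroup) (i : R.Index) : ∃ k : ℤ,
    crossing (BraidQuotient.toPair n q) (R.pair i) = 2 * k ∧
      Multiplicative.ofAdd (k : ZMod (R.modulus i)) = R.char i (R.toGroup q) := by
  obtain ⟨g, hg, h⟩ := q.2
  rw [← rep_toGroup] at hg
  rw [R.rep_injective hg]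
  exact h i

theorem toGroup_surjective : Function.Surjective R.toGroup := by
  intro g
  obtain ⟨q, hq⟩ := BraidQuotient.perm_surjective (R.rep g)
  have heven : ∀ i, ∃ k : ℤ, crossing (BraidQuotient.toPair n q) (R.pair i) = 2 * k := by
    intro i
    obtain ⟨a, b, h, hab, hfix⟩ := R.fixed i
    have hinv : ∀ c, R.rep g c = c → (R.rep g)⁻¹ c = c := fun c hc =>
      Equiv.Perm.inv_eq_iff_eq.2 hc.symm
    have := BraidQuotient.toPair_mem_parity q a b h
    rw [BraidQuotient.toPair_right, hq, hinv a (hfix g).1, hinv b (hfix g).2, iff_self,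
      iff_true, ← hab] at this
    exact this.exists_two_nsmul _ |>.imp fun k hk => by simpa using hk
  choose k hk using heven
  have hlift : ∀ i, ∃ c : ℤ, Multiplicative.ofAdd (c : ZMod (R.modulus i)) = R.char i g :=
    fun i => ZMod.intCast_surjective (R.char i g).toAdd
  choose c hc using hlift
  -- This translation adds `2 (c i - k i)` at the `i`-th marked pair, turning `2 k i` into the
  -- prescribed `2 c i` without changing the permutation.
  let t := BraidQuotient.translation n
    (Multiplicative.ofAdd (Function.extend R.pair (fun i => c i - k i) 0))
  have ht : BraidQuotient.perm n t = 1 := BraidQuotient.perm_translation _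
  have hperm : BraidQuotient.perm n (t * q) = R.rep g := by rw [map_mul, ht, one_mul, hq]
  have hmem : ↑t * q ∈ R.subgroup := by
    refine ⟨g, hperm, fun i => ⟨c i, ?_, hc i⟩⟩
    rw [map_mul, crossing_mul, BraidQuotient.crossing_translation, BraidQuotient.toPair_right, ht,
      inv_one, one_smul, hk, R.pair_injective.extend_apply]
    ring
  exact ⟨⟨_, hmem⟩, R.rep_injective ((rep_toGroup _).trans hperm)⟩

variable (R) in
/-- The index of the translation lattice in the direction of each pair. -/
def weight : OffDiag n → ℤ := Function.extend R.pair (fun i => (R.modulus i : ℤ)) 1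

theorem weight_pair (i : R.Index) : R.weight (R.pair i) = R.modulus i :=
  R.pair_injective.extend_apply _ _ i

theorem weight_pos (e : OffDiag n) : 0 < R.weight e := by
  by_cases h : ∃ i, R.pair i = e
  · obtain ⟨i, rfl⟩ := h
    rw [weight_pair]
    exact_mod_cast R.modulus_pos i
  · rw [weight, Function.extend_apply' _ _ _ h]
    exact one_pos

theorem translation_mem_iff (v : OffDiag n → ℤ) :
    (BraidQuotient.translation n (Multiplicative.ofAdd v) : BraidQuotient n) ∈ R.subgroup ↔
      ∀ e, R.weight e ∣ v e := by
  have hp := BraidQuotient.perm_translation (Multiplicative.ofAdd v)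
  constructor
  · intro h e
    by_cases he : ∃ i, R.pair i = e
    · obtain ⟨i, rfl⟩ := he
      obtain ⟨k, hk, hkg⟩ := exists_crossing_eq ⟨_, h⟩ i
      rw [(toGroup_eq_one_iff _).2 hp, map_one, ofAdd_eq_one, ZMod.intCast_zmod_eq_zero_iff_dvd]
        at hkg
      rw [BraidQuotient.crossing_translation] at hk
      rw [weight_pair, mul_left_cancel₀ two_ne_zero hk]
      exact hkg
    · rw [weight, Function.extend_apply' _ _ _ he]
      exact one_dvd _
  · intro h
    refine ⟨1, by rw [map_one, hp], fun i => ⟨v (R.pair i),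
      BraidQuotient.crossing_translation _ _, ?_⟩⟩
    rw [map_one, ofAdd_eq_one, ZMod.intCast_zmod_eq_zero_iff_dvd, ← weight_pair]
    exact h _

/-- A nonzero crossing at a marked pair suffices, as all of `G` fixes that pair. If there is none,
every character vanishes on the image in `G`, so the element is a nonzero translation and its
permutation fixes every pair. -/
theorem exists_crossing_ne_zero [NeZero n] {q : R.subgroup} (hq : q ≠ 1) :
    ∃ e, BraidQuotient.perm n q • e = e ∧ crossing (BraidQuotient.toPair n q) e ≠ 0 := by
  by_cases h : ∀ i, crossing (BraidQuotient.toPair n q) (R.pair i) = 0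
  · have h1 : R.toGroup q = 1 := R.eq_one _ fun i => by
      obtain ⟨k, hk, hkg⟩ := exists_crossing_eq q i
      rw [h i] at hk
      obtain rfl : k = 0 := by omega
      rw [← hkg, Int.cast_zero, ofAdd_zero]
    have h2 := (toGroup_eq_one_iff q).1 h1
    obtain ⟨v, hv⟩ := BraidQuotient.exists_eq_translation h2
    obtain ⟨e, he⟩ : ∃ e, v e ≠ 0 := by
      by_contra! h0
      refine hq (Subtype.ext (hv.trans ?_))
      rw [show v = 0 from funext h0, ofAdd_zero, map_one]
      rfl
    refine ⟨e, by rw [h2, one_smul], ?_⟩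
    rw [hv, BraidQuotient.crossing_translation]
    omega
  · push Not at h
    obtain ⟨i, hi⟩ := h
    exact ⟨R.pair i, by rw [← rep_toGroup, rep_smul_pair], hi⟩

theorem eq_one_of_isOfFinOrder [NeZero n] {q : R.subgroup} (hq : IsOfFinOrder q) : q = 1 := by
  by_contra hne
  obtain ⟨e, he, hc⟩ := exists_crossing_ne_zero hne
  obtain ⟨k, hk, hqk⟩ := isOfFinOrder_iff_pow_eq_one.1 hq
  have h := crossing_pow (x := BraidQuotient.toPair n q) (e := e) he k
  rw [← map_pow, ← Subgroup.coe_pow, hqk, Subgroup.coe_one, map_one, crossing_one] at h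
  exact mul_ne_zero (by exact_mod_cast hk.ne') hc h.symm

/-! ### The translation lattice and the holonomy sequence -/

variable {d : ℕ} (ε : OffDiag n ≃ Fin d)

variable (R) in
/-- The translation lattice of the subgroup. -/
def lattice : Multiplicative (Fin d → ℤ) →* R.subgroup where
  toFun v := ⟨BraidQuotient.translation n
    (Multiplicative.ofAdd fun e => R.weight e * v.toAdd (ε e)),
    (translation_mem_iff _).2 fun e => dvd_mul_right _ _⟩
  map_one' := Subtype.ext <| by
    have : (fun e => R.weight e * Multiplicative.toAdd (1 : Multiplicative (Fin d → ℤ)) (ε e)) =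
        0 := by
      ext e
      simp
    change ((BraidQuotient.translation n (Multiplicative.ofAdd _) : BraidQuotient.pure n) :
      BraidQuotient n) = 1
    rw [this, ofAdd_zero, map_one]
    rfl
  map_mul' v w := Subtype.ext <| by
    have : (fun e => R.weight e * (v * w).toAdd (ε e)) =
        (fun e => R.weight e * v.toAdd (ε e)) + fun e => R.weight e * w.toAdd (ε e) := by
      ext e
      simp [mul_add]
    change ((BraidQuotient.translation n (Multiplicative.ofAdd _) : BraidQuotient.pure n) :
      BraidQuotient n) = _
    rw [this, ofAdd_add, map_mul]
    rfl

theorem perm_lattice (v : Multiplicative (Fin d → ℤ)) :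
    BraidQuotient.perm n (R.lattice ε v) = 1 := BraidQuotient.perm_translation _

theorem crossing_lattice (v : Multiplicative (Fin d → ℤ)) (e : OffDiag n) :
    crossing (BraidQuotient.toPair n (R.lattice ε v)) e = 2 * (R.weight e * v.toAdd (ε e)) :=
  BraidQuotient.crossing_translation _ _

theorem lattice_injective : Function.Injective (R.lattice ε) := by
  intro v w h
  refine Multiplicative.toAdd.injective (funext fun k => ?_)
  have h1 := crossing_lattice (R := R) ε v (ε.symm k)
  rw [h, crossing_lattice, Equiv.apply_symm_apply] at h1
  exact (mul_left_cancel₀ (weight_pos _).ne' (mul_left_cancel₀ two_ne_zero h1)).symm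

theorem range_lattice [NeZero n] : (R.lattice ε).range = R.toGroup.ker := by
  ext q
  rw [MonoidHom.mem_ker, toGroup_eq_one_iff]
  constructor
  · rintro ⟨v, rfl⟩
    exact perm_lattice ε v
  · intro hq
    obtain ⟨v, hv⟩ := BraidQuotient.exists_eq_translation hq
    have h := (translation_mem_iff (R := R) v).1 (hv ▸ q.2)
    choose u hu using h
    refine ⟨Multiplicative.ofAdd fun k => u (ε.symm k), Subtype.ext (Eq.trans ?_ hv.symm)⟩
    have : v = fun e => R.weight e * u (ε.symm (ε e)) := funext fun e => by
      rw [Equiv.symm_apply_apply, ← hu]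
    rw [this]
    rfl

theorem hasHolonomyGroup [Finite G] (ε : OffDiag n ≃ Fin d) (hn : 3 ≤ n) : HasHolonomyGroup R.subgroup d G := by
  have : NeZero n := ⟨by omega⟩
  refine ⟨inferInstance, R.lattice ε, R.toGroup, lattice_injective ε, range_lattice ε,
    toGroup_surjective, fun q hq => ?_⟩
  rw [toGroup_eq_one_iff]
  refine OffDiag.eq_one_of_smul_eq hn fun e => ?_
  -- Conjugation moves the lattice vector supported at `e` to one supported at its image pair. Since
  -- `q` centralizes the lattice and the weights are nonzero, the two pairs coincide.
  have h := congrArg (fun x : R.subgroup =>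
      crossing (BraidQuotient.toPair n x) (BraidQuotient.perm n q • e))
    (hq (Multiplicative.ofAdd (Pi.single (ε e) 1)))
  simp only [Subgroup.coe_mul, Subgroup.coe_inv, map_mul, map_inv] at h
  rw [crossing_conj (perm_lattice ε _), BraidQuotient.toPair_right, inv_smul_smul,
    crossing_lattice, crossing_lattice, toAdd_ofAdd, Pi.single_eq_same] at h
  by_contra hne
  rw [Pi.single_eq_of_ne (fun h' => hne (ε.injective h'))] at h
  have := weight_pos (R := R) e
  omega

end MarkedRep

/-! ### The isometries attached to the elements of the semidirect product -/

namespace PairGroup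

variable {n d : ℕ} (ε : OffDiag n ≃ Fin d)

/-- The affine isometry which permutes the coordinates and translates by the crossing numbers. -/
def isometryFun (x : PairGroup n) : EuclideanIsometry d :=
  (LinearIsometryEquiv.piLpCongrLeft 2 ℝ ℝ
    ((ε.symm.trans (MulAction.toPerm x.right)).trans ε)).toAffineIsometryEquiv.trans
  (AffineIsometryEquiv.constVAdd ℝ _ (WithLp.toLp 2 fun k => (crossing x (ε.symm k) : ℝ)))

theorem isometryFun_apply (x : PairGroup n) (y : EuclideanSpace ℝ (Fin d)) (k : Fin d) :
    isometryFun ε x y k = y (ε (x.right⁻¹ • ε.symm k)) + crossing x (ε.symm k) := by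
  rw [add_comm]
  rfl

/-- The homomorphism from the semidirect product to the isometries of Euclidean space. -/
def toIsometry : PairGroup n →* EuclideanIsometry d where
  toFun := isometryFun ε
  map_one' := by
    ext y k
    rw [isometryFun_apply]
    simp [crossing_one]
  map_mul' x x' := by
    ext y k
    change _ = isometryFun ε x (isometryFun ε x' y) k
    rw [isometryFun_apply, isometryFun_apply, isometryFun_apply, crossing_mul,
      Equiv.symm_apply_apply, SemidirectProduct.mul_right, mul_inv_rev, mul_smul]
    push_cast
    ring

theorem toIsometry_apply (x : PairGroup n) (y : EuclideanSpace ℝ (Fin d)) (k : Fin d) :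
    toIsometry ε x y k = y (ε (x.right⁻¹ • ε.symm k)) + crossing x (ε.symm k) :=
  isometryFun_apply ε x y k

end PairGroup

/-! ### The isometric action of the subgroup -/

namespace MarkedRep

variable {G : Type*} [Group G] {n : ℕ} [NeZero n] (R : MarkedRep G n) {d : ℕ}
  (ε : OffDiag n ≃ Fin d)

/-- The action of the subgroup on Euclidean space. -/
@[reducible]
def flatAction : FlatAction R.subgroup d where
  toIsometry := (PairGroup.toIsometry ε).comp ((BraidQuotient.toPair n).comp R.subgroup.subtype)
  one_le_dist q hq x := by
    -- At a pair fixed by the permutation, the isometry only shifts the coordinate, and by a nonzero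
    -- integer.
    obtain ⟨e, he, hc⟩ := exists_crossing_ne_zero hq
    have h := toIsometry_apply ε (BraidQuotient.toPair n q) x (ε e)
    rw [Equiv.symm_apply_apply, BraidQuotient.toPair_right, inv_smul_eq_iff.2 he.symm] at h
    have h2 := PiLp.norm_apply_le (PairGroup.toIsometry ε (BraidQuotient.toPair n q) x - x) (ε e)
    rw [PiLp.sub_apply, h, add_sub_cancel_left, Real.norm_eq_abs] at h2
    rw [dist_eq_norm]
    refine le_trans ?_ h2
    exact_mod_cast Int.one_le_abs hc
  exists_norm_le := by
    -- The lattice shifts the `k`-th coordinate by multiples of twice the weight; the floor brings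
    -- it into `[0, 2 * weight)`, whence the bound.
    refine ⟨√(∑ k, (2 * (R.weight (ε.symm k) : ℝ)) ^ 2), fun x =>
      ⟨R.lattice ε (Multiplicative.ofAdd fun k => -⌊x k / (2 * R.weight (ε.symm k))⌋), ?_⟩⟩
    rw [EuclideanSpace.norm_eq]
    refine Real.sqrt_le_sqrt (Finset.sum_le_sum fun k _ => ?_)
    have hw : (0 : ℝ) < 2 * R.weight (ε.symm k) := by
      have := weight_pos (R := R) (ε.symm k)
      positivity
    have h := toIsometry_apply ε (BraidQuotient.toPair n (R.lattice ε
      (Multiplicative.ofAdd fun k => -⌊x k / (2 * R.weight (ε.symm k))⌋))) x k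
    rw [BraidQuotient.toPair_right, perm_lattice, inv_one, one_smul, crossing_lattice,
      Equiv.apply_symm_apply, toAdd_ofAdd] at h
    rw [Real.norm_eq_abs, sq_abs]
    have h1 := Int.floor_le (x k / (2 * R.weight (ε.symm k)))
    have h2 := Int.lt_floor_add_one (x k / (2 * R.weight (ε.symm k)))
    rw [le_div_iff₀ hw] at h1
    rw [div_lt_iff₀ hw] at h2
    push_cast at h
    refine sq_le_sq' ?_ ?_
    · refine le_trans ?_ h.ge
      linarith
    · refine h.le.trans ?_
      linarith

theorem linearPart_eq_one_iff (hn : 3 ≤ n) (q : R.subgroup) :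
    letI := R.flatAction ε
    FlatAction.linearPart d q = 1 ↔ R.toGroup q = 1 := by
  let := R.flatAction ε
  have h : ∀ y k, FlatAction.linearPart d q y k =
      y (ε ((BraidQuotient.perm n q)⁻¹ • ε.symm k)) := fun _ _ => rfl
  rw [toGroup_eq_one_iff]
  constructor
  · intro h1
    rw [← inv_eq_one]
    refine OffDiag.eq_one_of_smul_eq hn fun e => ?_
    have h2 := h (EuclideanSpace.single (ε e) (1 : ℝ)) (ε e)
    rw [h1, Equiv.symm_apply_apply] at h2
    by_contra hne
    have h3 : ε ((BraidQuotient.perm n q)⁻¹ • e) ≠ ε e := fun h' => hne (ε.injective h')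
    simp [h3] at h2
  · intro h1
    ext y k
    rw [h, h1, inv_one, one_smul, Equiv.apply_symm_apply]
    rfl

end MarkedRep

/-! ### Existence of marked representations, and the conclusion -/

theorem exists_markedRep (G : Type*) [CommGroup G] [Finite G] :
    ∃ n, 3 ≤ n ∧ Nonempty (MarkedRep G n) := by
  obtain ⟨ι, _, m, hm, ⟨f⟩⟩ := CommGroup.equiv_prod_multiplicative_zmod_of_finite G
  have : Fintype G := Fintype.ofFinite G
  -- The regular representation on `G` gives faithfulness, `ι × Bool` gives two fixed points per
  -- cyclic factor, and three idle points ensure `n ≥ 3`.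
  let Ω := G ⊕ (ι × Bool) ⊕ Fin 3
  let κ : Ω ≃ Fin (Fintype.card Ω) := Fintype.equivFin Ω
  let ρ : G →* Equiv.Perm Ω :=
    (Equiv.Perm.sumCongrHom G _).comp ((MulAction.toPermHom G G).prod 1)
  let p : ι → Bool → Fin (Fintype.card Ω) := fun i b => κ (Sum.inr (Sum.inl (i, b)))
  have hp : ∀ i b j c, p i b = p j c ↔ i = j ∧ b = c := fun i b j c =>
    ⟨fun h => Prod.mk.inj (Sum.inl.inj (Sum.inr.inj (κ.injective h))),
      fun h => by rw [h.1, h.2]⟩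
  have hfix : ∀ g i b, κ.permCongrHom (ρ g) (p i b) = p i b := fun g i b => by
    change κ (ρ g (κ.symm (κ _))) = _
    rw [Equiv.symm_apply_apply]
    rfl
  have hne : ∀ i, p i false ≠ p i true := by simp [hp]
  refine ⟨Fintype.card Ω, ?_, ⟨{
    Index := ι
    rep := κ.permCongrHom.toMonoidHom.comp ρ
    rep_injective := fun g h hgh => ?_
    modulus := m
    modulus_pos := fun i => by have := hm i; omega
    char := fun i => (Pi.evalMonoidHom _ i).comp f.toMonoidHom
    eq_one := fun g hg => (map_eq_one_iff f f.injective).1 (funext hg)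
    pair := fun i => OffDiag.mk (p i false) (p i true) (hne i)
    pair_injective := fun i j hij => ?_
    fixed := fun i => ⟨p i false, p i true, hne i, rfl, fun g => ⟨hfix g i _, hfix g i _⟩⟩ }⟩⟩
  · simp only [Ω, Fintype.card_sum, Fintype.card_fin]
    omega
  · have h1 : ρ g = ρ h := κ.permCongrHom.injective hgh
    have h2 : g * 1 = h * 1 := Sum.inl.inj (DFunLike.congr_fun h1 (Sum.inl 1))
    simpa using h2
  · rw [OffDiag.mk_eq_mk] at hij
    simp only [hp] at hij
    rcases hij with h | h
    · exact h.1.1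
    · exact h.1.1

theorem card_offDiag (n : ℕ) : Fintype.card (OffDiag n) = n * (n - 1) / 2 := by
  rw [Sym2.card_subtype_not_diag, Fintype.card_fin, Nat.choose_two_right]

theorem theorem1p1 (G : Type*) [CommGroup G] [Finite G] :
    ∃ n : ℕ, 3 ≤ n ∧
      (∃ j : G →* Equiv.Perm (Fin n), Function.Injective j) ∧
      ∃ Γ : Subgroup (BraidQuotient n),
        IsBieberbachGroup Γ (n * (n - 1) / 2) ∧
        HasHolonomyGroup Γ (n * (n - 1) / 2) G ∧
        ∃ X : ClosedRiemannianManifold (n * (n - 1) / 2),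
          X.metric.IsFlat ∧
          (∀ x : X.carrier, Nonempty (FundamentalGroup X.carrier x ≃* Γ)) ∧
          (∀ x : X.carrier, Nonempty (X.metric.holonomyGroup x ≃* G)) := by
  obtain ⟨n, hn, ⟨R⟩⟩ := exists_markedRep G
  have : NeZero n := ⟨by omega⟩
  let ε := Fintype.equivFinOfCardEq (card_offDiag n)
  let := R.flatAction ε
  exact ⟨n, hn, ⟨R.rep, R.rep_injective⟩, R.subgroup,
    ⟨⟨_, FlatAction.toIsometry_injective, FlatAction.isCrystallographicSubgroup_range _ _⟩,
      fun _ => MarkedRep.eq_one_of_isOfFinOrder⟩,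
    MarkedRep.hasHolonomyGroup ε hn,
    FlatAction.closedManifold R.subgroup _, FlatAction.isFlat_metric,
    FlatAction.nonempty_fundamentalGroup_mulEquiv _ _,
    FlatAction.nonempty_holonomyGroup_mulEquiv MarkedRep.toGroup_surjective
      (R.linearPart_eq_one_iff ε hn)⟩

end
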